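/- Let $(\bar M,\bar\varphi,\bar\xi_\alpha,\bar\eta^\alpha,\bar g)$, $\alpha\in\{1,\dots,r\}$, $r\ge 1$, be an indefinite $\mathcal S$-manifold. That is: $\bar g$ is a semi-Riemannian metric on $\bar M$ of index $\nu$, $0<\nu<\dim\bar M$; $\bar\varphi\neq 0$ is a $(1,1)$-tensor field of constant rank whose kernel has the global frame $\bar\xi_1,\dots,\bar\xi_r$, with dual $1$-forms $\bar\eta^\alpha$, $\bar\eta^\alpha(\bar\xi_\beta)=\delta^\alpha_\beta$, $\bar\varphi^2=-I+\sum_\alpha\bar\eta^\alpha\otimes\bar\xi_\alpha$; $\bar g(\bar\varphi X,\bar\varphi Y)=\bar g(X,Y)-\sum_\alpha\varepsilon_\alpha\bar\eta^\alpha(X)\bar\eta^\alpha(Y)$, where $\varepsilon_\alpha=\pm1$ according to whether $\bar\xi_\alpha$ is spacelike or timelike; $N_{\bar\varphi}+2\sum_\alpha d\bar\eta^\alpha\otimes\bar\xi_\alpha=0$, where $N_{\bar\varphi}$ is the Nijenhuis torsion; and $d\bar\eta^\alpha(X,Y)=\bar g(X,\bar\varphi Y)$ for every $\alpha$ (with the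 convention $2\,d\eta(X,Y)=X(\eta(Y))-Y(\eta(X))-\eta([X,Y])$). All data are smooth; $\bar\nabla$ is the Levi-Civita connection of $\bar g$. Let $M$ be an immersed lightlike hypersurface of $\bar M$ (its induced metric $g$ has a one-dimensional radical $\mathrm{Rad}(T_pM)$ at every $p$) to which all $\bar\xi_\alpha$ are tangent, and let $S(TM)$ be a characteristic screen distribution: a smooth distribution with $TM=\mathrm{Rad}(TM)\oplus S(TM)$, $\ker\bar\varphi\subset S(TM)$ and $\bar\varphi(\mathrm{Rad}(TM))\subset S(TM)$. Let $\mathrm{ltr}(M)$ be the lightlike transversal line bundle of $S(TM)$: for a nowhere zero section $E$ of $\mathrm{Rad}(TM)$ on an open set $\mathcal U\subset M$, it is spanned over $\mathcal U$ by the section $N$ of $T\bar M|_M$ with $\bar g(N,E)=1$, $\bar g(N,N)=0$ and $\bar g(N,W)=0$ for all $W\in S(TM)$. Let $D_0$ be the orthogonal complement of $\bar\varphi(\mathrm{Rad}(TM))\oplus\bar\varphi(\mathrm{ltr}(M))$ in $S(TM)$. For vector fields $X,Y$ tangent to $M$ write $\bar\nabla_XY=\nabla_XY+h(X,Y)$ according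 to $T\bar M|_M=TM\oplus\mathrm{ltr}(M)$ and, if $Y$ is a section of $S(TM)$, $\nabla_XY=\overset{*}{\nabla}_XY+\overset{*}{h}(X,Y)$ according to $TM=S(TM)\oplus\mathrm{Rad}(TM)$, with $\overset{*}{\nabla}_XY\in S(TM)$ and $\overset{*}{h}(X,Y)\in\mathrm{Rad}(TM)$. Given $E$ and $N$ on $\mathcal U$ as above, set $$B(X,Y)=\bar g(h(X,Y),E),\qquad C(X,Y)=\bar g(\overset{*}{h}(X,Y),N).$$ If $D_0$ is integrable (brackets of local sections of $D_0$ are sections of $D_0$), then for every open $\mathcal U\subset M$, all $E$, $N$ on $\mathcal U$ as above and all smooth sections $X,Y$ of $D_0$ over $\mathcal U$, $$B(\bar\varphi X,\bar\varphi Y)=-B(X,Y),\qquad C(\bar\varphi X,\bar\varphi Y)=-C(X,Y)\quad\text{on }\mathcal U.$$ -/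

import Mathlib

open Bundle Set VectorField
open scoped Manifold ContDiff Topology

noncomputable section

namespace LightlikeGeometry

/-! ### Linear algebra -/

/-- `v ↦` the component of `v` in `A` with respect to the direct sum decomposition `A ⊕ B` of the
whole space (and `0` if `A` and `B` are not complementary). -/
def component {W : Type*} [AddCommGroup W] [Module ℝ W] (A B : Submodule ℝ W) (v : W) : W :=
  open Classical in
  if h : IsCompl A B then A.projection B h v else 0

/-- The set of dimensions of the subspaces on which `b` is negative definite. The index of `b` is
the greatest element of this set. -/
def negDims {W : Type*} [AddCommGroup W] [Module ℝ W] (b : W → W → ℝ) : Set ℕ :=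
  {k | ∃ A : Submodule ℝ W, Module.finrank ℝ A = k ∧ ∀ w ∈ A, w ≠ 0 → b w w < 0}

/-! ### Semi-Riemannian metrics and the Levi-Civita connection -/

section Ambient

variable (V : Type*) [NormedAddCommGroup V] [NormedSpace ℝ V]
  (M : Type*) [TopologicalSpace M] [ChartedSpace V M] [IsManifold 𝓘(ℝ, V) ∞ M]

/-- A smooth semi-Riemannian metric of constant index on `M`. -/
structure SemiRiemannianMetric where
  /-- The scalar product on each tangent space. -/
  g (x : M) : TangentSpace 𝓘(ℝ, V) x →L[ℝ] TangentSpace 𝓘(ℝ, V) x →L[ℝ] ℝ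
  symm (x : M) (v w : TangentSpace 𝓘(ℝ, V) x) : g x v w = g x w v
  nondegenerate (x : M) (v : TangentSpace 𝓘(ℝ, V) x) : (∀ w, g x v w = 0) → v = 0
  contMDiff : ContMDiff 𝓘(ℝ, V) (𝓘(ℝ, V).prod 𝓘(ℝ, V →L[ℝ] V →L[ℝ] ℝ)) ∞
    (fun x ↦ TotalSpace.mk' (V →L[ℝ] V →L[ℝ] ℝ)
      (E := fun x : M ↦ TangentSpace 𝓘(ℝ, V) x →L[ℝ] TangentSpace 𝓘(ℝ, V) x →L[ℝ] ℝ) x (g x))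
  /-- The index. -/
  index : ℕ
  index_spec (x : M) : IsGreatest (negDims fun v w ↦ g x v w) index

variable {V M}

/-- `∇` is the Levi-Civita connection of the metric: it is torsion-free and metric.
Here `∇ Y x v` stands for `(∇_v Y)(x)`. -/
structure SemiRiemannianMetric.IsLeviCivita (G : SemiRiemannianMetric V M)
    (nabla : CovariantDerivative 𝓘(ℝ, V) V (TangentSpace 𝓘(ℝ, V) : M → Type _)) : Prop where
  torsion_free (X Y : Π x : M, TangentSpace 𝓘(ℝ, V) x) (x : M) :
    MDiffAt (T% X) x → MDiffAt (T% Y) x →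
      nabla Y x (X x) - nabla X x (Y x) = mlieBracket 𝓘(ℝ, V) X Y x
  metric (Y Z : Π x : M, TangentSpace 𝓘(ℝ, V) x) (x : M) (v : TangentSpace 𝓘(ℝ, V) x) :
    MDiffAt (T% Y) x → MDiffAt (T% Z) x →
      mvfderiv 𝓘(ℝ, V) (fun y ↦ G.g y (Y y) (Z y)) x v =
        G.g x (nabla Y x v) (Z x) + G.g x (Y x) (nabla Z x v)

/-- The exterior derivative of a `1`-form, evaluated on vector fields, with the convention
`2 dη(X, Y) = X(η(Y)) - Y(η(X)) - η([X, Y])`. -/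
def dForm (η : Π x : M, TangentSpace 𝓘(ℝ, V) x →L[ℝ] ℝ)
    (X Y : Π x : M, TangentSpace 𝓘(ℝ, V) x) (x : M) : ℝ :=
  (1 / 2) * (mvfderiv 𝓘(ℝ, V) (fun y ↦ η y (Y y)) x (X x)
    - mvfderiv 𝓘(ℝ, V) (fun y ↦ η y (X y)) x (Y x)
    - η x (mlieBracket 𝓘(ℝ, V) X Y x))

/-- The Nijenhuis torsion of a `(1,1)`-tensor field, evaluated on vector fields:
`N_φ(X, Y) = φ²[X, Y] + [φX, φY] - φ[φX, Y] - φ[X, φY]`. -/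
def nijenhuis (φ : Π x : M, TangentSpace 𝓘(ℝ, V) x →L[ℝ] TangentSpace 𝓘(ℝ, V) x)
    (X Y : Π x : M, TangentSpace 𝓘(ℝ, V) x) (x : M) : TangentSpace 𝓘(ℝ, V) x :=
  φ x (φ x (mlieBracket 𝓘(ℝ, V) X Y x))
    + mlieBracket 𝓘(ℝ, V) (fun y ↦ φ y (X y)) (fun y ↦ φ y (Y y)) x
    - φ x (mlieBracket 𝓘(ℝ, V) (fun y ↦ φ y (X y)) Y x)
    - φ x (mlieBracket 𝓘(ℝ, V) X (fun y ↦ φ y (Y y)) x)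

/-! ### Indefinite metric `g.f.f`-manifolds and indefinite `S`-manifolds -/

variable (V M) in
/-- An indefinite metric globally framed `f`-structure `(φ, ξ_α, η^α, g)`, `α ∈ {1, …, r}`,
on `M`. -/
structure IndefiniteMetricGFF (r : ℕ) extends SemiRiemannianMetric V M where
  r_pos : 0 < r
  /-- The `(1,1)`-tensor field. -/
  φ (x : M) : TangentSpace 𝓘(ℝ, V) x →L[ℝ] TangentSpace 𝓘(ℝ, V) x
  φ_contMDiff : ContMDiff 𝓘(ℝ, V) (𝓘(ℝ, V).prod 𝓘(ℝ, V →L[ℝ] V)) ∞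
    (fun x ↦ TotalSpace.mk' (V →L[ℝ] V)
      (E := fun x : M ↦ TangentSpace 𝓘(ℝ, V) x →L[ℝ] TangentSpace 𝓘(ℝ, V) x) x (φ x))
  φ_ne_zero : ∃ x, φ x ≠ 0
  φ_rank : ∃ k : ℕ, ∀ x, Module.finrank ℝ (LinearMap.range (φ x).toLinearMap) = k
  /-- The characteristic vector fields. -/
  ξ (α : Fin r) (x : M) : TangentSpace 𝓘(ℝ, V) x
  ξ_contMDiff (α : Fin r) : ContMDiff 𝓘(ℝ, V) 𝓘(ℝ, V).tangent ∞
    (fun x ↦ (⟨x, ξ α x⟩ : TangentBundle 𝓘(ℝ, V) M))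
  /-- The dual `1`-forms. -/
  η (α : Fin r) (x : M) : TangentSpace 𝓘(ℝ, V) x →L[ℝ] ℝ
  η_contMDiff (α : Fin r) : ContMDiff 𝓘(ℝ, V) (𝓘(ℝ, V).prod 𝓘(ℝ, V →L[ℝ] ℝ)) ∞
    (fun x ↦ TotalSpace.mk' (V →L[ℝ] ℝ)
      (E := fun x : M ↦ TangentSpace 𝓘(ℝ, V) x →L[ℝ] ℝ) x (η α x))
  /-- The causal characters of the characteristic vector fields. -/
  ε (α : Fin r) : ℝ
  ε_spec (α : Fin r) :
    (ε α = 1 ∧ ∀ x, 0 < g x (ξ α x) (ξ α x)) ∨ (ε α = -1 ∧ ∀ x, g x (ξ α x) (ξ α x) < 0)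
  φ_ξ (α : Fin r) (x : M) : φ x (ξ α x) = 0
  η_ξ (α β : Fin r) (x : M) : η α x (ξ β x) = if α = β then 1 else 0
  φ_sq (x : M) (v : TangentSpace 𝓘(ℝ, V) x) : φ x (φ x v) = -v + ∑ α, η α x v • ξ α x
  compat (x : M) (v w : TangentSpace 𝓘(ℝ, V) x) :
    g x (φ x v) (φ x w) = g x v w - ∑ α, ε α * η α x v * η α x w
  index_pos : 0 < index
  index_lt : index < Module.finrank ℝ V

/-- An indefinite `S`-manifold: the structure is normal, and `dη^α = Φ` for every `α`, where
`Φ(X, Y) = g(X, φY)`. Both conditions are tensorial. -/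
structure IndefiniteMetricGFF.IsSManifold {r : ℕ} (G : IndefiniteMetricGFF V M r) : Prop where
  normal (X Y : Π x : M, TangentSpace 𝓘(ℝ, V) x) (x : M) :
    MDiffAt (T% X) x → MDiffAt (T% Y) x →
      nijenhuis G.φ X Y x + ∑ α, (2 * dForm (G.η α) X Y x) • G.ξ α x = 0
  dη_eq (α : Fin r) (X Y : Π x : M, TangentSpace 𝓘(ℝ, V) x) (x : M) :
    MDiffAt (T% X) x → MDiffAt (T% Y) x → dForm (G.η α) X Y x = G.g x (X x) (G.φ x (Y x))

end Ambient

/-! ### Vector fields and connections along a map -/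

section Along

variable {V : Type*} [NormedAddCommGroup V] [NormedSpace ℝ V]
  {N : Type*} [TopologicalSpace N] [ChartedSpace V N]
  {V' : Type*} [NormedAddCommGroup V'] [NormedSpace ℝ V']
  {M : Type*} [TopologicalSpace M] [ChartedSpace V' M]

/-- The differential `T_p M → T_{i(p)} N`. -/
abbrev push (i : M → N) (p : M) :
    TangentSpace 𝓘(ℝ, V') p →L[ℝ] TangentSpace 𝓘(ℝ, V) (i p) :=
  mfderiv 𝓘(ℝ, V') 𝓘(ℝ, V) i p

/-- The tangent space of `M` at `p`, as a subspace of the tangent space of `N` at `i(p)`. -/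
def tangentImage (i : M → N) (p : M) : Submodule ℝ (TangentSpace 𝓘(ℝ, V) (i p)) :=
  LinearMap.range (push (V := V) (V' := V') i p).toLinearMap

/-- For an immersion `i` and a vector `w` of `N` at `i(p)` which is tangent to `M`: the unique
vector of `M` at `p` with image `w`. -/
def lift (i : M → N) (p : M) (w : TangentSpace 𝓘(ℝ, V) (i p)) : TangentSpace 𝓘(ℝ, V') p :=
  Function.invFun (push (V := V) (V' := V') i p) w

/-- The covariant derivative `∇_v W` at `p` of a vector field `W` along `i : M → N` in the direction
`v ∈ T_p M`, for a connection `∇` on `N`. Writing `W = ∑ W^k (e_k ∘ i)` in the coordinate frame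
`e_k` of the chart of `N` at `i(p)`, it is `∑ (v(W^k) e_k + W^k(p) ∇_{i_* v} e_k)`. -/
def covAlong [FiniteDimensional ℝ V] [IsManifold 𝓘(ℝ, V) ∞ N]
    (nabla : CovariantDerivative 𝓘(ℝ, V) V (TangentSpace 𝓘(ℝ, V) : N → Type _))
    (i : M → N) (W : Π p : M, TangentSpace 𝓘(ℝ, V) (i p)) (p : M)
    (v : TangentSpace 𝓘(ℝ, V') p) : TangentSpace 𝓘(ℝ, V) (i p) :=
  let e := trivializationAt V (TangentSpace 𝓘(ℝ, V) : N → Type _) (i p)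
  let b := Module.finBasis ℝ V
  ∑ k, (mvfderiv 𝓘(ℝ, V') (fun q ↦ e.localFrameCoeff 𝓘(ℝ, V) b k (i q) (W q)) p v •
      e.localFrame b k (i p)
    + e.localFrameCoeff 𝓘(ℝ, V) b k (i p) (W p) •
      nabla (e.localFrame b k) (i p) (push i p v))

end Along

/-! ### Distributions -/

section Distribution

variable {V : Type*} [NormedAddCommGroup V] [NormedSpace ℝ V]
  {M : Type*} [TopologicalSpace M] [ChartedSpace V M] [IsManifold 𝓘(ℝ, V) ∞ M]

/-- `X` is a smooth section over `U` of the family of subspaces `D`. -/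
def IsSectionOn (D : Π p : M, Submodule ℝ (TangentSpace 𝓘(ℝ, V) p)) (U : Set M)
    (X : Π p : M, TangentSpace 𝓘(ℝ, V) p) : Prop :=
  ContMDiffOn 𝓘(ℝ, V) 𝓘(ℝ, V).tangent ∞ (fun p ↦ (⟨p, X p⟩ : TangentBundle 𝓘(ℝ, V) M)) U ∧
    ∀ p ∈ U, X p ∈ D p

/-- `D` is a smooth distribution (a smooth subbundle of `TM`): it has constant rank and smooth
local frames. -/
def IsSmoothDistribution (D : Π p : M, Submodule ℝ (TangentSpace 𝓘(ℝ, V) p)) : Prop :=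
  ∃ k : ℕ, ∀ p₀ : M, ∃ U : Set M, IsOpen U ∧ p₀ ∈ U ∧
    ∃ e : Fin k → Π p : M, TangentSpace 𝓘(ℝ, V) p, (∀ j, IsSectionOn D U (e j)) ∧
      ∀ p ∈ U, LinearIndependent ℝ (fun j ↦ e j p) ∧ Submodule.span ℝ (range fun j ↦ e j p) = D p

/-- `D` is integrable (involutive): the bracket of two local sections of `D` is a section
of `D`. -/
def IsIntegrable (D : Π p : M, Submodule ℝ (TangentSpace 𝓘(ℝ, V) p)) : Prop :=
  ∀ (U : Set M), IsOpen U → ∀ X Y : Π p : M, TangentSpace 𝓘(ℝ, V) p,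
    IsSectionOn D U X → IsSectionOn D U Y → ∀ p ∈ U, mlieBracket 𝓘(ℝ, V) X Y p ∈ D p

end Distribution

/-! ### Characteristic lightlike hypersurfaces -/

section Hypersurface

variable {V : Type*} [NormedAddCommGroup V] [NormedSpace ℝ V] [FiniteDimensional ℝ V]
  {N : Type*} [TopologicalSpace N] [ChartedSpace V N] [IsManifold 𝓘(ℝ, V) ∞ N]
  {V' : Type*} [NormedAddCommGroup V'] [NormedSpace ℝ V']
  {M : Type*} [TopologicalSpace M] [ChartedSpace V' M] [IsManifold 𝓘(ℝ, V') ∞ M]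

/-- The radical `Rad(T_p M)` of the metric induced on `M` by `i : M → N`. -/
def radical (G : SemiRiemannianMetric V N) (i : M → N) (p : M) :
    Submodule ℝ (TangentSpace 𝓘(ℝ, V') p) where
  carrier := {v | ∀ w : TangentSpace 𝓘(ℝ, V') p, G.g (i p) (push i p v) (push i p w) = 0}
  add_mem' {a b} ha hb w := by simp [ha w, hb w]
  zero_mem' w := by simp
  smul_mem' c v hv w := by simp [hv w]

variable (V' M) in
/-- A characteristic lightlike hypersurface `M` of an indefinite metric `g.f.f`-manifold `N`,
together with a characteristic screen distribution `S(TM)`. -/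
structure CharLightlikeHypersurface {r : ℕ} (G : IndefiniteMetricGFF V N r) where
  /-- The immersion of `M` into the ambient manifold. -/
  i : M → N
  immersion : Manifold.IsImmersion 𝓘(ℝ, V') 𝓘(ℝ, V) ∞ i
  codim : Module.finrank ℝ V = Module.finrank ℝ V' + 1
  lightlike (p : M) : Module.finrank ℝ
    (radical (V' := V') G.toSemiRiemannianMetric i p) = 1
  ξ_tangent (α : Fin r) (p : M) : G.ξ α (i p) ∈ tangentImage (V' := V') i p
  /-- The screen distribution. -/
  S (p : M) : Submodule ℝ (TangentSpace 𝓘(ℝ, V') p)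
  S_smooth : IsSmoothDistribution S
  S_compl (p : M) : IsCompl (radical G.toSemiRiemannianMetric i p) (S p)
  ker_φ_le (p : M) (w : TangentSpace 𝓘(ℝ, V) (i p)) :
    G.φ (i p) w = 0 → w ∈ (S p).map (push i p).toLinearMap
  φ_radical_le (p : M) (v : TangentSpace 𝓘(ℝ, V') p) :
    v ∈ radical G.toSemiRiemannianMetric i p →
      G.φ (i p) (push i p v) ∈ (S p).map (push i p).toLinearMap

namespace CharLightlikeHypersurface

variable {r : ℕ} {G : IndefiniteMetricGFF V N r} (L : CharLightlikeHypersurface V' M G)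

/-- The radical distribution `Rad(TM)`. -/
def Rad (p : M) : Submodule ℝ (TangentSpace 𝓘(ℝ, V') p) :=
  radical G.toSemiRiemannianMetric L.i p

/-- For `e ∈ Rad(T_p M)`: the vector `n` of the ambient manifold at `p` satisfies
`g(n, e) = 1`, `g(n, n) = 0` and `g(n, w) = 0` for all `w ∈ S(T_p M)`. -/
def IsTransversal (p : M) (e : TangentSpace 𝓘(ℝ, V') p) (n : TangentSpace 𝓘(ℝ, V) (L.i p)) :
    Prop :=
  G.g (L.i p) n (push L.i p e) = 1 ∧ G.g (L.i p) n n = 0 ∧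
    ∀ w ∈ L.S p, G.g (L.i p) n (push L.i p w) = 0

/-- The lightlike transversal bundle `ltr(M)`. -/
def ltr (p : M) : Submodule ℝ (TangentSpace 𝓘(ℝ, V) (L.i p)) :=
  Submodule.span ℝ {n | ∃ e ∈ L.Rad p, L.IsTransversal p e n}

/-- The distribution `D₀`: the orthogonal complement of `φ(Rad(TM)) ⊕ φ(ltr(M))` in `S(TM)`. -/
def D₀ (p : M) : Submodule ℝ (TangentSpace 𝓘(ℝ, V') p) where
  carrier := {v | v ∈ L.S p ∧
    (∀ e ∈ L.Rad p, G.g (L.i p) (push L.i p v) (G.φ (L.i p) (push L.i p e)) = 0) ∧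
    ∀ n ∈ L.ltr p, G.g (L.i p) (push L.i p v) (G.φ (L.i p) n) = 0}
  add_mem' {a b} ha hb := ⟨add_mem ha.1 hb.1,
    fun e he ↦ by simp [ha.2.1 e he, hb.2.1 e he], fun n hn ↦ by simp [ha.2.2 n hn, hb.2.2 n hn]⟩
  zero_mem' := ⟨zero_mem _, fun e _ ↦ by simp, fun n _ ↦ by simp⟩
  smul_mem' c v hv := ⟨Submodule.smul_mem _ c hv.1,
    fun e he ↦ by simp [hv.2.1 e he], fun n hn ↦ by simp [hv.2.2 n hn]⟩

/-- The vector field `φX` on `M`, for a vector field `X` on `M` such that `φX` is tangent to `M`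
(as it is for every section `X` of `D₀`). -/
def φTan (X : Π p : M, TangentSpace 𝓘(ℝ, V') p) (p : M) : TangentSpace 𝓘(ℝ, V') p :=
  lift L.i p (G.φ (L.i p) (push L.i p (X p)))

variable (nabla : CovariantDerivative 𝓘(ℝ, V) V (TangentSpace 𝓘(ℝ, V) : N → Type _))

/-- The ambient covariant derivative `∇̄_X Y` of vector fields `X`, `Y` on `M`. -/
def ambientCov (X Y : Π p : M, TangentSpace 𝓘(ℝ, V') p) (p : M) :
    TangentSpace 𝓘(ℝ, V) (L.i p) :=
  covAlong nabla L.i (fun q ↦ push L.i q (Y q)) p (X p)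

/-- The induced connection `∇_X Y`: the component of `∇̄_X Y` in `TM`, with respect to
`TM ⊕ ltr(M)`. -/
def inducedCov (X Y : Π p : M, TangentSpace 𝓘(ℝ, V') p) (p : M) : TangentSpace 𝓘(ℝ, V') p :=
  lift L.i p (component (tangentImage (V' := V') L.i p) (L.ltr p) (L.ambientCov nabla X Y p))

/-- The second fundamental form `h(X, Y)` of `M`: the component of `∇̄_X Y` in `ltr(M)`, with
respect to `TM ⊕ ltr(M)`. -/
def h (X Y : Π p : M, TangentSpace 𝓘(ℝ, V') p) (p : M) : TangentSpace 𝓘(ℝ, V) (L.i p) :=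
  component (L.ltr p) (tangentImage (V' := V') L.i p) (L.ambientCov nabla X Y p)

/-- The second fundamental form `h*(X, Y)` of the screen distribution, for a section `Y` of
`S(TM)`: the component of `∇_X Y` in `Rad(TM)`, with respect to `Rad(TM) ⊕ S(TM)`. -/
def hStar (X Y : Π p : M, TangentSpace 𝓘(ℝ, V') p) (p : M) : TangentSpace 𝓘(ℝ, V') p :=
  component (L.Rad p) (L.S p) (L.inducedCov nabla X Y p)

/-- The local second fundamental form `B(X, Y) = g(h(X, Y), E)` of `M`. -/
def B (E X Y : Π p : M, TangentSpace 𝓘(ℝ, V') p) (p : M) : ℝ :=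
  G.g (L.i p) (L.h nabla X Y p) (push L.i p (E p))

/-- The local second fundamental form `C(X, Y) = g(h*(X, Y), ν)` of the screen distribution, for
a section `Y` of `S(TM)` and the local section `ν` of `ltr(M)`. -/
def C (ν : Π p : M, TangentSpace 𝓘(ℝ, V) (L.i p)) (X Y : Π p : M, TangentSpace 𝓘(ℝ, V') p)
    (p : M) : ℝ :=
  G.g (L.i p) (push L.i p (L.hStar nabla X Y p)) (ν p)

end CharLightlikeHypersurface

end Hypersurface

end LightlikeGeometry

end

/-! Fix a point and let n be E or N there. Since N is orthogonal to S(TM) and to itself, and E to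
TM, both forms are ambient scalar products: B(X, Y) = g(∇̄_X Y, E) and C(X, Y) = g(∇̄_X Y, N)
(`B_eq`, `C_eq`). Both choices of n satisfy the same three conditions: D₀ is orthogonal to n, D₀ is
orthogonal to φn, and η^α(n) = 0 for all α. Moreover D₀ is φ-invariant (`φTan_mem_D₀`). A single
computation, `g_ambientCov_φ`, therefore gives both equalities.

In that computation, φ is skew-adjoint, so g(∇̄_{φX} φY, n) = g((∇̄_{φX} φ)Y, n) - g(∇̄_{φX} Y, φn).
Integrability puts [φX, Y] in D₀, which is orthogonal to φn, so the last product equals g(∇̄_Y φX,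
φn) = g((∇̄_Y φ)X, φn) + g(∇̄_Y X, n). Integrability once more replaces ∇̄_Y X by ∇̄_X Y. It remains
to see that g((∇̄_{φX} φ)Y, n) = g((∇̄_Y φ)X, φn).

This is where the S-structure enters. Differentiating g(φ·, φ·) = g - ∑ ε_α η^α ⊗ η^α (`covφ_φ`)
turns the right side into g((∇̄_Y φ)φX, n), because ∇̄ξ_α has no component along n in the directions
concerned (`nabla_ξ_normal`). What is left is the symmetry of g((∇̄_u φ)v, n) in u and v,
`covφ_normal_symm`. It follows from normality (`covφ_normal`) and from the closedness of Φ = dη^α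
(`covφ_cyclic`). -/

namespace LightlikeGeometry

/-! ### Brackets, second derivatives and commuting extensions, in a chart. -/

section Calculus

variable {V : Type*} [NormedAddCommGroup V] [NormedSpace ℝ V] [CompleteSpace V]
  {M : Type*} [TopologicalSpace M] [ChartedSpace V M] [IsManifold 𝓘(ℝ, V) ∞ M]
  {F : Type*} [NormedAddCommGroup F] [NormedSpace ℝ F]

omit [CompleteSpace V] in
-- The tangent space at x is identified with the model space through the preferred chart at x, whose
-- derivative at x is thus the identity.
theorem inverse_mfderiv_extChartAt_self (x : M) (v : TangentSpace 𝓘(ℝ, V) x) :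
    (mfderiv 𝓘(ℝ, V) 𝓘(ℝ, V) (extChartAt 𝓘(ℝ, V) x) x).inverse v = v := by
  have i1 : IsManifold 𝓘(ℝ, V) 1 M := inferInstance
  rw [mfderiv_extChartAt_self]
  exact congr($(ContinuousLinearMap.inverse_id (R := ℝ) (M := TangentSpace 𝓘(ℝ, V) x)) v)

/-- The derivative along `[X, Y]` is the commutator of the derivatives along `X` and `Y`. -/
theorem mvfderiv_mlieBracket {f : M → F} {x : M} (hf : ContMDiffAt 𝓘(ℝ, V) 𝓘(ℝ, F) 2 f x)
    {X Y : Π x : M, TangentSpace 𝓘(ℝ, V) x} (hX : MDiffAt (T% X) x) (hY : MDiffAt (T% Y) x) :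
    MDiffAt (fun y ↦ mvfderiv 𝓘(ℝ, V) f y (Y y)) x ∧
    mvfderiv 𝓘(ℝ, V) f x (mlieBracket 𝓘(ℝ, V) X Y x) =
      mvfderiv 𝓘(ℝ, V) (fun y ↦ mvfderiv 𝓘(ℝ, V) f y (Y y)) x (X x) -
      mvfderiv 𝓘(ℝ, V) (fun y ↦ mvfderiv 𝓘(ℝ, V) f y (X y)) x (Y x) := by
  have i2 : IsManifold 𝓘(ℝ, V) 2 M := inferInstance
  have i1 : IsManifold 𝓘(ℝ, V) 1 M := inferInstance
  set φ := extChartAt 𝓘(ℝ, V) x with hφ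
  have hx : x ∈ φ.source := mem_extChartAt_source x
  have hxt : φ x ∈ φ.target := φ.map_source hx
  have htgt : φ.target ∈ 𝓝 (φ x) := extChartAt_target_mem_nhds x
  have hlx : φ.symm (φ x) = x := φ.left_inv hx
  -- `pb Z` is Z read in the chart. Through it the claim becomes `fderiv_apply_lieBracket`, that is,
  -- the symmetry of the second derivative of `f ∘ φ.symm`.
  let pb (Z : Π x : M, TangentSpace 𝓘(ℝ, V) x) : V → V := mpullback 𝓘(ℝ, V) 𝓘(ℝ, V) φ.symm Z
  have hsymm {z : V} (hz : z ∈ φ.target) : MDiffAt φ.symm z := by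
    rw [← mdifferentiableWithinAt_univ, ← range_id]
    exact mdifferentiableWithinAt_extChartAt_symm (I := 𝓘(ℝ, V)) hz
  have hinv {z : V} (hz : z ∈ φ.target) :
      (mfderiv 𝓘(ℝ, V) 𝓘(ℝ, V) φ.symm z).IsInvertible := by
    rw [← mfderivWithin_univ, ← range_id]
    exact isInvertible_mfderivWithin_extChartAt_symm (I := 𝓘(ℝ, V)) hz
  have hpush {z : V} (hz : z ∈ φ.target) (Z : Π x : M, TangentSpace 𝓘(ℝ, V) x) :
      mfderiv 𝓘(ℝ, V) 𝓘(ℝ, V) φ.symm z (pb Z z) = Z (φ.symm z) :=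
    congr($((hinv hz).self_comp_inverse) (Z (φ.symm z)))
  have hpbx (Z : Π x : M, TangentSpace 𝓘(ℝ, V) x) : pb Z (φ x) = Z x := by
    have h := mfderivWithin_extChartAt_symm_inverse_apply (I := 𝓘(ℝ, V)) (x := x) (Z x)
    rw [modelWithCornersSelf_coe, range_id, mfderivWithin_univ] at h
    have h' (y : M) (hy : y = x) : (Z y : V) = (Z x : V) := by subst hy; rfl
    refine Eq.trans ?_ h
    exact congrArg (mfderiv 𝓘(ℝ, V) 𝓘(ℝ, V) φ.symm (φ x)).inverse (h' _ hlx)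
  have hpb {Z : Π x : M, TangentSpace 𝓘(ℝ, V) x} (hZ : MDiffAt (T% Z) x) :
      DifferentiableAt ℝ (pb Z) (φ x) := by
    have := MDifferentiableWithinAt.differentiableWithinAt_mpullbackWithin_vectorField
      (s := univ) (V := Z) hZ.mdifferentiableWithinAt
    rw [modelWithCornersSelf_coe, range_id, preimage_univ, inter_univ,
      mpullbackWithin_univ] at this
    exact differentiableWithinAt_univ.mp this
  have hbr : mlieBracket 𝓘(ℝ, V) X Y x = lieBracket ℝ (pb X) (pb Y) (φ x) := by
    rw [← mlieBracketWithin_univ, mlieBracketWithin_apply]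
    rw [modelWithCornersSelf_coe, range_id, preimage_univ, inter_univ,
      mpullbackWithin_univ, mpullbackWithin_univ]
    refine (inverse_mfderiv_extChartAt_self x _).trans ?_
    exact congrFun (lieBracketWithin_univ (𝕜 := ℝ) (V := pb X) (W := pb Y)) (φ x)
  have hφc : ContinuousAt φ.symm (φ x) := continuousAt_extChartAt_symm x
  have hmf : ∀ᶠ z in 𝓝 (φ x), MDiffAt f (φ.symm z) := by
    have h := (contMDiffAt_iff_contMDiffAt_nhds (by simp)).1 hf
    rw [← hlx] at h
    filter_upwards [hφc.eventually h] with z hz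
    exact hz.mdifferentiableAt (by simp)
  have hder (Z : Π x : M, TangentSpace 𝓘(ℝ, V) x) :
      (fun z ↦ fderiv ℝ (f ∘ φ.symm) z (pb Z z)) =ᶠ[𝓝 (φ x)]
        (fun y ↦ mvfderiv 𝓘(ℝ, V) f y (Z y)) ∘ φ.symm := by
    filter_upwards [hmf, htgt] with z hz hzt
    have h1 := mfderiv_comp_apply z hz (hsymm hzt) (pb Z z)
    rw [hpush hzt, mfderiv_eq_fderiv] at h1
    exact h1
  have hcd : ContDiffAt ℝ 2 (f ∘ φ.symm) (φ x) := by
    rw [← contMDiffAt_iff_contDiffAt]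
    refine ContMDiffAt.comp (I' := 𝓘(ℝ, V)) (φ x) (hlx.symm ▸ hf) ?_
    have := contMDiffWithinAt_extChartAt_symm_range (I := 𝓘(ℝ, V)) (n := 2) x hxt
    rwa [modelWithCornersSelf_coe, range_id] at this
  have hdd {Z : Π x : M, TangentSpace 𝓘(ℝ, V) x} (hZ : MDiffAt (T% Z) x) :
      DifferentiableAt ℝ (fun z ↦ fderiv ℝ (f ∘ φ.symm) z (pb Z z)) (φ x) := by
    have := (hcd.fderiv_right (m := 1) (by norm_num)).differentiableAt (by simp)
    exact this.clm_apply (hpb hZ)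
  -- Derivatives at x on the manifold agree with those at `φ x` in the chart, with no change of the
  -- vector, because the derivative of `φ` at x is the identity.
  have hloc {g : V → F} {h : M → F} (hg : g =ᶠ[𝓝 (φ x)] h ∘ φ.symm)
      (hgd : DifferentiableAt ℝ g (φ x)) : MDiffAt h x ∧
      ∀ v, mvfderiv 𝓘(ℝ, V) h x v = fderiv ℝ g (φ x) v := by
    have he : h =ᶠ[𝓝 x] g ∘ φ := by
      filter_upwards [(continuousAt_extChartAt (I := 𝓘(ℝ, V)) x).eventually hg,
        extChartAt_source_mem_nhds (I := 𝓘(ℝ, V)) x] with y hy hys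
      rw [Function.comp_apply, hy, Function.comp_apply, φ.left_inv hys]
    have hφd : MDiffAt φ x := mdifferentiableAt_extChartAt (mem_chart_source V x)
    have hgm : MDiffAt g (φ x) := hgd.mdifferentiableAt
    refine ⟨(hgm.comp x hφd).congr_of_eventuallyEq he, fun v ↦ ?_⟩
    have h1 := mfderiv_comp_apply x hgm hφd v
    rw [← he.mfderiv_eq, mfderiv_eq_fderiv, mfderiv_extChartAt_self] at h1
    exact h1
  refine ⟨(hloc (hder Y) (hdd hY)).1, ?_⟩
  rw [(hloc (hder Y) (hdd hY)).2, (hloc (hder X) (hdd hX)).2,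
    (hloc (g := f ∘ φ.symm) (h := f) .rfl (hcd.differentiableAt (by norm_num))).2, hbr,
    ← hpbx X, ← hpbx Y]
  exact fderiv_apply_lieBracket hcd (by simp) (hpb hY) (hpb hX)

/-- Every tangent vector extends to a smooth vector field such that the extensions commute. -/
theorem exists_commuting_extension (x : M) :
    ∃ c : TangentSpace 𝓘(ℝ, V) x → Π y : M, TangentSpace 𝓘(ℝ, V) y,
      (∀ v, c v x = v) ∧ (∀ v, ContMDiffAt 𝓘(ℝ, V) 𝓘(ℝ, V).tangent ∞ (T% (c v)) x) ∧
      ∀ v w, ∀ᶠ y in 𝓝 x, mlieBracket 𝓘(ℝ, V) (c v) (c w) y = 0 := by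
  have i2 : IsManifold 𝓘(ℝ, V) 2 M := inferInstance
  have i1 : IsManifold 𝓘(ℝ, V) 1 M := inferInstance
  set φ := extChartAt 𝓘(ℝ, V) x with hφ
  let cst (v : V) : Π z : V, TangentSpace 𝓘(ℝ, V) z := fun _ ↦ v
  have hsm (v : V) (z : V) : ContMDiffAt 𝓘(ℝ, V) 𝓘(ℝ, V).tangent ∞ (T% (cst v)) z := by
    rw [contMDiffAt_vectorSpace_iff_contDiffAt]
    exact contDiffAt_const
  have hbr (v w : V) : lieBracket ℝ (fun _ : V ↦ v) (fun _ : V ↦ w) = 0 := by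
    ext z
    simp [lieBracket]
  -- The extensions are the chart pullbacks of constant fields, and pullback commutes with the
  -- bracket.
  refine ⟨fun v ↦ mpullback 𝓘(ℝ, V) 𝓘(ℝ, V) φ (cst v), fun v ↦ ?_, fun v ↦ ?_, fun v w ↦ ?_⟩
  · exact inverse_mfderiv_extChartAt_self x v
  · exact ContMDiffAt.mpullback_vectorField_preimage (n := ∞) (hsm v _) contMDiffAt_extChartAt
      (isInvertible_mfderiv_extChartAt (mem_extChartAt_source x)) (by simp)
  · filter_upwards [extChartAt_source_mem_nhds (I := 𝓘(ℝ, V)) x] with y hy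
    have i2le : (2 : ℕ∞ω) ≤ ∞ := ENat.LEInfty.out
    have i3 : IsManifold 𝓘(ℝ, V) (minSmoothness ℝ 2) M := by
      rwa [minSmoothness_of_isRCLikeNormedField]
    rw [← mpullback_mlieBracket (n := ∞)]
    · have : mlieBracket 𝓘(ℝ, V) (cst v) (cst w) = 0 := by
        rw [← mlieBracketWithin_univ, mlieBracketWithin_eq_lieBracketWithin]
        exact lieBracketWithin_univ.trans (hbr v w)
      rw [this, mpullback_zero]
      rfl
    · exact (hsm v _).mdifferentiableAt (by simp)
    · exact (hsm w _).mdifferentiableAt (by simp)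
    · exact contMDiffAt_extChartAt' (by rwa [extChartAt_source] at hy)
    · simpa using i2le

omit [CompleteSpace V] [IsManifold 𝓘(ℝ, V) ∞ M] in
theorem mvfderiv_congr {f g : M → F} {x : M} (h : f =ᶠ[𝓝 x] g) (v : TangentSpace 𝓘(ℝ, V) x) :
    mvfderiv 𝓘(ℝ, V) f x v = mvfderiv 𝓘(ℝ, V) g x v :=
  congr($(h.mfderiv_eq (I := 𝓘(ℝ, V)) (I' := 𝓘(ℝ, F))) v)

end Calculus

/-! ### Algebra of the structure tensors, and ∇φ as a tensor. -/

section Pointwise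

variable {V : Type*} [NormedAddCommGroup V] [NormedSpace ℝ V]
  {M : Type*} [TopologicalSpace M] [ChartedSpace V M] [IsManifold 𝓘(ℝ, V) ∞ M]
  {r : ℕ} (G : IndefiniteMetricGFF V M r)

theorem SemiRiemannianMetric.mdifferentiableAt_g (G : SemiRiemannianMetric V M) {x : M}
    {X Y : Π x : M, TangentSpace 𝓘(ℝ, V) x} (hX : MDiffAt (T% X) x) (hY : MDiffAt (T% Y) x) :
    MDiffAt (fun y ↦ G.g y (X y) (Y y)) x := by
  have h : MDifferentiableAt 𝓘(ℝ, V) (𝓘(ℝ, V).prod 𝓘(ℝ, ℝ))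
      (fun y ↦ TotalSpace.mk' ℝ (E := Bundle.Trivial M ℝ) y (G.g y (X y) (Y y))) x :=
    MDifferentiableAt.clm_bundle_apply₂ (F₁ := V) (F₂ := V)
      (G.contMDiff.mdifferentiableAt (by simp)) hX hY
  exact ((mdifferentiableAt_totalSpace ..).1 h).2

variable {G} in
theorem IndefiniteMetricGFF.mdifferentiableAt_φ {x : M}
    {X : Π x : M, TangentSpace 𝓘(ℝ, V) x} (hX : MDiffAt (T% X) x) :
    MDiffAt (T% (fun y ↦ G.φ y (X y))) x :=
  MDifferentiableAt.clm_bundle_apply (F₁ := V) (F₂ := V)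
      (G.φ_contMDiff.mdifferentiableAt (by simp)) hX

theorem IndefiniteMetricGFF.contMDiffAt_η (α : Fin r) {x : M}
    {X : Π x : M, TangentSpace 𝓘(ℝ, V) x}
    (hX : ContMDiffAt 𝓘(ℝ, V) 𝓘(ℝ, V).tangent ∞ (T% X) x) :
    ContMDiffAt 𝓘(ℝ, V) 𝓘(ℝ, ℝ) ∞ (fun y ↦ G.η α y (X y)) x := by
  have h : ContMDiffAt 𝓘(ℝ, V) (𝓘(ℝ, V).prod 𝓘(ℝ, ℝ)) ∞
      (fun y ↦ TotalSpace.mk' ℝ (E := Bundle.Trivial M ℝ) y (G.η α y (X y))) x :=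
    ContMDiffAt.clm_bundle_apply (F₁ := V) (F₂ := ℝ) (G.η_contMDiff α).contMDiffAt hX
  exact (contMDiffAt_totalSpace.1 h).2

theorem IndefiniteMetricGFF.mdifferentiableAt_η (α : Fin r) {x : M}
    {X : Π x : M, TangentSpace 𝓘(ℝ, V) x} (hX : MDiffAt (T% X) x) :
    MDiffAt (fun y ↦ G.η α y (X y)) x := by
  have h : MDifferentiableAt 𝓘(ℝ, V) (𝓘(ℝ, V).prod 𝓘(ℝ, ℝ))
      (fun y ↦ TotalSpace.mk' ℝ (E := Bundle.Trivial M ℝ) y (G.η α y (X y))) x :=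
    MDifferentiableAt.clm_bundle_apply (F₁ := V) (F₂ := ℝ)
      ((G.η_contMDiff α).mdifferentiableAt (by simp)) hX
  exact ((mdifferentiableAt_totalSpace ..).1 h).2

theorem IndefiniteMetricGFF.mdifferentiableAt_ξ (α : Fin r) (x : M) :
    MDiffAt (T% (G.ξ α)) x :=
  (G.ξ_contMDiff α).mdifferentiableAt (by simp)

/-! Algebra of the structure tensors -/

theorem IndefiniteMetricGFF.η_φ (α : Fin r) (x : M) (v : TangentSpace 𝓘(ℝ, V) x) :
    G.η α x (G.φ x v) = 0 := by
  have h := G.φ_sq x (G.φ x v)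
  have h' := congrArg (G.φ x) (G.φ_sq x v)
  simp only [map_add, map_neg, map_sum, map_smul, G.φ_ξ, smul_zero, Finset.sum_const_zero,
    add_zero] at h'
  rw [h'] at h
  have h2 := congrArg (G.η α x) h
  simpa [G.η_ξ] using h2

theorem IndefiniteMetricGFF.ε_sq (α : Fin r) : G.ε α * G.ε α = 1 := by
  rcases G.ε_spec α with ⟨h, _⟩ | ⟨h, _⟩ <;> simp [h]

theorem IndefiniteMetricGFF.g_ξ (α : Fin r) (x : M) (v : TangentSpace 𝓘(ℝ, V) x) :
    G.g x (G.ξ α x) v = G.ε α * G.η α x v := by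
  have h := G.compat x (G.ξ α x) v
  simp only [G.φ_ξ, map_zero, zero_apply, G.η_ξ] at h
  simp only [mul_ite, mul_one, mul_zero, ite_mul, zero_mul, Finset.sum_ite_eq',
    Finset.mem_univ, if_true] at h
  linarith

theorem IndefiniteMetricGFF.g_φ_left (x : M) (v w : TangentSpace 𝓘(ℝ, V) x) :
    G.g x (G.φ x v) w = -G.g x v (G.φ x w) := by
  have h := G.compat x v (G.φ x w)
  simp only [G.η_φ, mul_zero, Finset.sum_const_zero, sub_zero, G.φ_sq, map_add, map_neg, map_sum,
    map_smul] at h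
  have h2 (α : Fin r) : G.g x (G.φ x v) (G.ξ α x) = 0 := by
    rw [G.symm, G.g_ξ, G.η_φ, mul_zero]
  simp only [h2, smul_zero, Finset.sum_const_zero] at h
  linarith

variable [FiniteDimensional ℝ V]
  (nabla : CovariantDerivative 𝓘(ℝ, V) V (TangentSpace 𝓘(ℝ, V) : M → Type _))

omit [FiniteDimensional ℝ V] in
-- In the commutator of ∇ and φ the terms differentiating the factor f cancel. This is what makes ∇φ
-- a pointwise bilinear map.
theorem IndefiniteMetricGFF.tensorialAt_nabla_φ (x : M) :
    TensorialAt 𝓘(ℝ, V) V (fun Y : Π x : M, TangentSpace 𝓘(ℝ, V) x ↦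
      nabla (fun y ↦ G.φ y (Y y)) x - (G.φ x).comp (nabla Y x)) x where
  smul {f Y} hf hY := by
    have e : (fun y ↦ G.φ y ((f • Y) y)) = f • fun y ↦ G.φ y (Y y) := by
      ext y; simp
    rw [e, nabla.isCovariantDerivativeOnUniv.leibniz hY hf,
      nabla.isCovariantDerivativeOnUniv.leibniz (G.mdifferentiableAt_φ hY) hf]
    ext v
    simp
    module
  add {Y Z} hY hZ := by
    have e : (fun y ↦ G.φ y ((Y + Z) y)) = (fun y ↦ G.φ y (Y y)) + fun y ↦ G.φ y (Z y) := by
      ext y; simp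
    rw [e, nabla.isCovariantDerivativeOnUniv.add hY hZ,
      nabla.isCovariantDerivativeOnUniv.add (G.mdifferentiableAt_φ hY) (G.mdifferentiableAt_φ hZ)]
    ext v
    simp
    module

/-- The covariant derivative of `φ`: `G.covφ nabla x w v` is `(∇_v φ) w`. -/
noncomputable def IndefiniteMetricGFF.covφ (x : M) :
    TangentSpace 𝓘(ℝ, V) x →L[ℝ] TangentSpace 𝓘(ℝ, V) x →L[ℝ] TangentSpace 𝓘(ℝ, V) x :=
  TensorialAt.mkHom _ x (G.tensorialAt_nabla_φ nabla x)

variable {nabla} in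
theorem IndefiniteMetricGFF.nabla_φ {x : M} {Y : Π x : M, TangentSpace 𝓘(ℝ, V) x}
    (hY : MDiffAt (T% Y) x) (v : TangentSpace 𝓘(ℝ, V) x) :
    nabla (fun y ↦ G.φ y (Y y)) x v = G.covφ nabla x (Y x) v + G.φ x (nabla Y x v) := by
  have h := TensorialAt.mkHom_apply (G.tensorialAt_nabla_φ nabla x) hY
  have h2 : G.covφ nabla x (Y x) v = _ := congr($h v)
  rw [h2]
  simp

end Pointwise

/-! ### Identities for ∇φ and ∇ξ on an indefinite S-manifold. -/

section Identities

variable {V : Type*} [NormedAddCommGroup V] [NormedSpace ℝ V] [FiniteDimensional ℝ V]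
  {M : Type*} [TopologicalSpace M] [ChartedSpace V M] [IsManifold 𝓘(ℝ, V) ∞ M]
  {r : ℕ} {G : IndefiniteMetricGFF V M r}
  {nabla : CovariantDerivative 𝓘(ℝ, V) V (TangentSpace 𝓘(ℝ, V) : M → Type _)}

theorem exists_mdifferentiable_extension (x : M) (v : TangentSpace 𝓘(ℝ, V) x) :
    ∃ X : Π y : M, TangentSpace 𝓘(ℝ, V) y, X x = v ∧ MDiffAt (T% X) x :=
  have : CompleteSpace V := FiniteDimensional.complete ℝ V
  have ⟨c, hc, hs, _⟩ := exists_commuting_extension x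
  ⟨c v, hc v, (hs v).mdifferentiableAt (by simp)⟩

/-- φ is skew-adjoint and ∇ is metric, so ∇φ is skew-adjoint too. -/
theorem IndefiniteMetricGFF.covφ_skew (hnabla : G.IsLeviCivita nabla) {x : M}
    (a b w : TangentSpace 𝓘(ℝ, V) x) :
    G.g x (G.covφ nabla x b a) w = -G.g x (G.covφ nabla x w a) b := by
  obtain ⟨Y, rfl, hY⟩ := exists_mdifferentiable_extension x b
  obtain ⟨W, rfl, hW⟩ := exists_mdifferentiable_extension x w
  have h1 := hnabla.metric _ _ x a (G.mdifferentiableAt_φ hY) hW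
  have h2 := hnabla.metric _ _ x a hY (G.mdifferentiableAt_φ hW)
  have e : (fun y ↦ G.g y (G.φ y (Y y)) (W y)) = -fun y ↦ G.g y (Y y) (G.φ y (W y)) := by
    ext y; exact G.g_φ_left _ _ _
  rw [e, mvfderiv_neg, neg_apply, h2, G.nabla_φ hY, G.nabla_φ hW] at h1
  simp only [map_add, add_apply, G.g_φ_left] at h1
  rw [G.symm x (Y x)] at h1
  linarith

omit [FiniteDimensional ℝ V] in
-- Since η^α = ε_α g(ξ_α, ·), this is metric compatibility, with the sign removed by ε_α² = 1.
theorem IndefiniteMetricGFF.mvfderiv_η (hnabla : G.IsLeviCivita nabla) {x : M} (α : Fin r)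
    {Y : Π y : M, TangentSpace 𝓘(ℝ, V) y} (hY : MDiffAt (T% Y) x) (a : TangentSpace 𝓘(ℝ, V) x) :
    mvfderiv 𝓘(ℝ, V) (fun y ↦ G.η α y (Y y)) x a =
      G.ε α * G.g x (nabla (G.ξ α) x a) (Y x) + G.η α x (nabla Y x a) := by
  have h1 := hnabla.metric _ _ x a (G.mdifferentiableAt_ξ α x) hY
  have e : (fun y ↦ G.g y (G.ξ α y) (Y y)) = (fun _ ↦ G.ε α) * fun y ↦ G.η α y (Y y) := by
    ext y; exact G.g_ξ _ _ _
  rw [e, mvfderiv_mul mdifferentiableAt_const (G.mdifferentiableAt_η α hY), mvfderiv_const,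
    smul_zero, add_zero, G.g_ξ] at h1
  simp only [smul_apply, smul_eq_mul] at h1
  have h2 := G.ε_sq α
  linear_combination G.ε α * h1 - (mvfderiv 𝓘(ℝ, V) (fun y ↦ G.η α y (Y y)) x a
    - G.η α x (nabla Y x a)) * h2

/-- The equation dη^α = Φ, with the bracket written by the torsion-free connection: it determines
the antisymmetric part of ∇ξ_α. -/
theorem IndefiniteMetricGFF.nabla_ξ_skew (hG : G.IsSManifold) (hnabla : G.IsLeviCivita nabla)
    {x : M} (α : Fin r) (u v : TangentSpace 𝓘(ℝ, V) x) :
    G.ε α * (G.g x (nabla (G.ξ α) x u) v - G.g x (nabla (G.ξ α) x v) u) =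
      2 * G.g x u (G.φ x v) := by
  obtain ⟨X, rfl, hX⟩ := exists_mdifferentiable_extension x u
  obtain ⟨Y, rfl, hY⟩ := exists_mdifferentiable_extension x v
  have h := hG.dη_eq α X Y x hX hY
  rw [dForm, G.mvfderiv_η hnabla α hX, G.mvfderiv_η hnabla α hY,
    ← hnabla.torsion_free X Y x hX hY, map_sub] at h
  linear_combination 2 * h

theorem IndefiniteMetricGFF.covφ_ξ (α : Fin r) (x : M) (a : TangentSpace 𝓘(ℝ, V) x) :
    G.covφ nabla x (G.ξ α x) a = -G.φ x (nabla (G.ξ α) x a) := by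
  have h := G.nabla_φ (nabla := nabla) (G.mdifferentiableAt_ξ α x) a
  have e : (fun y ↦ G.φ y (G.ξ α y)) = 0 := by ext y; exact G.φ_ξ α y
  rw [e, nabla.zero] at h
  exact eq_neg_of_add_eq_zero_left h.symm

theorem IndefiniteMetricGFF.g_covφ_ξ (α : Fin r) (x : M) (a w : TangentSpace 𝓘(ℝ, V) x) :
    G.g x (G.covφ nabla x (G.ξ α x) a) w = G.g x (nabla (G.ξ α) x a) (G.φ x w) := by
  rw [G.covφ_ξ, map_neg, neg_apply, G.g_φ_left, neg_neg]

/-- `d(dη) = 0`, in terms of `∇φ`. -/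
theorem IndefiniteMetricGFF.covφ_cyclic (hG : G.IsSManifold) (hnabla : G.IsLeviCivita nabla)
    {x : M} (u v w : TangentSpace 𝓘(ℝ, V) x) :
    G.g x (G.covφ nabla x v u) w + G.g x (G.covφ nabla x w v) u
      + G.g x (G.covφ nabla x u w) v = 0 := by
  have : CompleteSpace V := FiniteDimensional.complete ℝ V
  obtain ⟨c, hc, hs, hbr⟩ := exists_commuting_extension (V := V) x
  have hd (v) : MDiffAt (T% (c v)) x := (hs v).mdifferentiableAt (by simp)
  have hdn (v) : ∀ᶠ y in 𝓝 x, MDiffAt (T% (c v)) y := by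
    have := (contMDiffAt_iff_contMDiffAt_nhds (n := 1) (by simp)).1 ((hs v).of_le (by simp))
    filter_upwards [this] with y hy
    exact hy.mdifferentiableAt (by simp)
  -- All the dη^α equal Φ, so one index is enough; r > 0 supplies it.
  let α : Fin r := ⟨0, G.r_pos⟩
  -- `D u v w` is the second derivative u(v(η(w))) along the commuting extensions; it is symmetric
  -- in u and v.
  let D (u v w : TangentSpace 𝓘(ℝ, V) x) : ℝ := mvfderiv 𝓘(ℝ, V)
    (fun y ↦ mvfderiv 𝓘(ℝ, V) (fun z ↦ G.η α z (c w z)) y (c v y)) x u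
  have hη (w) := G.contMDiffAt_η α (hs w)
  have hcomm (u v w) := mvfderiv_mlieBracket ((hη w).of_le ENat.LEInfty.out) (hd u) (hd v)
  have hD (u v w) : D u v w = D v u w := by
    have := (hcomm u v w).2
    rw [(hbr u v).self_of_nhds, map_zero, hc, hc] at this
    exact (sub_eq_zero.1 this.symm)
  have hΦ (u v w) : mvfderiv 𝓘(ℝ, V) (fun y ↦ G.g y (c v y) (G.φ y (c w y))) x u =
      1 / 2 * (D u v w - D u w v) := by
    have e : (fun y ↦ G.g y (c v y) (G.φ y (c w y))) =ᶠ[𝓝 x] fun y ↦ 1 / 2 *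
        (mvfderiv 𝓘(ℝ, V) (fun z ↦ G.η α z (c w z)) y (c v y) -
          mvfderiv 𝓘(ℝ, V) (fun z ↦ G.η α z (c v z)) y (c w y)) := by
      filter_upwards [hdn v, hdn w, hbr v w] with y h1 h2 h3
      rw [← hG.dη_eq α _ _ y h1 h2, dForm, h3, map_zero, sub_zero]
    rw [mvfderiv_congr e, mvfderiv_fun_mul (g := fun y ↦
        mvfderiv 𝓘(ℝ, V) (fun z ↦ G.η α z (c w z)) y (c v y) -
          mvfderiv 𝓘(ℝ, V) (fun z ↦ G.η α z (c v z)) y (c w y)) mdifferentiableAt_const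
        ((hcomm u v w).1.sub (hcomm u w v).1),
      mvfderiv_const, smul_zero, add_zero, mvfderiv_fun_sub (hcomm u v w).1 (hcomm u w v).1]
    rfl
  have hA (u v w) : G.g x (G.covφ nabla x w u) v = 1 / 2 * (D u v w - D u w v)
      - G.g x (nabla (c v) x u) (G.φ x w) + G.g x (nabla (c w) x u) (G.φ x v) := by
    have h := hnabla.metric _ _ x u (hd v) (G.mdifferentiableAt_φ (hd w))
    rw [hΦ, G.nabla_φ (hd w), hc, hc, map_add, G.symm x v, G.symm x v, G.g_φ_left] at h
    linarith
  have ht (u v) : nabla (c v) x u = nabla (c u) x v := by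
    have := hnabla.torsion_free _ _ x (hd u) (hd v)
    rw [(hbr u v).self_of_nhds, hc, hc] at this
    exact sub_eq_zero.1 this
  -- In the cyclic sum the second derivatives cancel by `hD` and the first-order terms by `ht`.
  rw [hA, hA, hA, ht u v, ht w u, ht w v, hD u v w, hD w v u, hD w u v]
  ring

omit [FiniteDimensional ℝ V] [IsManifold 𝓘(ℝ, V) ∞ M] in
theorem mvfderiv_finsetSum {ι : Type*} (s : Finset ι) {f : ι → M → ℝ} {x : M}
    (hf : ∀ i ∈ s, MDiffAt (f i) x) (v : TangentSpace 𝓘(ℝ, V) x) :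
    MDiffAt (fun y ↦ ∑ i ∈ s, f i y) x ∧
    mvfderiv 𝓘(ℝ, V) (fun y ↦ ∑ i ∈ s, f i y) x v = ∑ i ∈ s, mvfderiv 𝓘(ℝ, V) (f i) x v := by
  classical
  induction s using Finset.induction_on with
  | empty => simpa [mvfderiv_const] using mdifferentiableAt_const
  | insert i s hi ih =>
    have h := ih fun j hj ↦ hf j (Finset.mem_insert_of_mem hj)
    have hfi := hf i (Finset.mem_insert_self i s)
    simp only [Finset.sum_insert hi]
    refine ⟨hfi.add h.1, ?_⟩
    rw [mvfderiv_fun_add hfi h.1, add_apply, h.2]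

/-- The derivative of `φ² = -I + ∑ η ⊗ ξ`. -/
theorem IndefiniteMetricGFF.covφ_φ (hnabla : G.IsLeviCivita nabla) {x : M}
    (a b w : TangentSpace 𝓘(ℝ, V) x) :
    G.g x (G.covφ nabla x b a) (G.φ x w) + G.g x (G.covφ nabla x w a) (G.φ x b) =
      -∑ α, (G.g x (nabla (G.ξ α) x a) b * G.η α x w +
        G.η α x b * G.g x (nabla (G.ξ α) x a) w) := by
  obtain ⟨Y, rfl, hY⟩ := exists_mdifferentiable_extension x b
  obtain ⟨W, rfl, hW⟩ := exists_mdifferentiable_extension x w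
  have h1 := hnabla.metric _ _ x a hY hW
  have h2 := hnabla.metric _ _ x a (G.mdifferentiableAt_φ hY) (G.mdifferentiableAt_φ hW)
  have hηY (α : Fin r) := G.mdifferentiableAt_η α hY
  have hηW (α : Fin r) := G.mdifferentiableAt_η α hW
  -- Differentiating the scalar compatibility identity carries the information of φ² and avoids
  -- differentiating the section ∑ η^α(Y) ξ_α.
  have e : (fun y ↦ G.g y (G.φ y (Y y)) (G.φ y (W y))) = (fun y ↦ G.g y (Y y) (W y)) -
      fun y ↦ ∑ α, G.ε α * (G.η α y (Y y) * G.η α y (W y)) := by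
    ext y
    simp only [Pi.sub_apply, G.compat, mul_assoc]
  have hm (α : Fin r) : MDiffAt (fun y ↦ G.ε α * (G.η α y (Y y) * G.η α y (W y))) x :=
    mdifferentiableAt_const.mul ((hηY α).mul (hηW α))
  have hd (α : Fin r) :
      mvfderiv 𝓘(ℝ, V) (fun y ↦ G.ε α * (G.η α y (Y y) * G.η α y (W y))) x a =
      G.g x (nabla (G.ξ α) x a) (Y x) * G.η α x (W x) +
        G.η α x (Y x) * G.g x (nabla (G.ξ α) x a) (W x) +
        (G.ε α * G.η α x (nabla Y x a) * G.η α x (W x) +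
          G.ε α * G.η α x (Y x) * G.η α x (nabla W x a)) := by
    rw [mvfderiv_fun_mul (g := fun y ↦ G.η α y (Y y) * G.η α y (W y)) mdifferentiableAt_const
      ((hηY α).mul (hηW α)), mvfderiv_const, smul_zero, add_zero,
      mvfderiv_fun_mul (hηY α) (hηW α)]
    simp only [smul_apply, add_apply, smul_eq_mul, G.mvfderiv_η hnabla α hY,
      G.mvfderiv_η hnabla α hW]
    linear_combination (G.g x (nabla (G.ξ α) x a) (Y x) * G.η α x (W x) +
        G.η α x (Y x) * G.g x (nabla (G.ξ α) x a) (W x)) * G.ε_sq α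
  have hsum := mvfderiv_finsetSum Finset.univ (fun α _ ↦ hm α) a
  rw [e, mvfderiv_sub (G.mdifferentiableAt_g hY hW) hsum.1,
    sub_apply, hsum.2, h1, G.nabla_φ hY, G.nabla_φ hW] at h2
  simp only [hd, Finset.sum_add_distrib, map_add, add_apply, G.compat] at h2
  rw [G.symm x (G.φ x (Y x))] at h2
  rw [Finset.sum_add_distrib]
  linarith

/-- The normality condition in terms of `∇φ`. -/
theorem IndefiniteMetricGFF.covφ_normal (hG : G.IsSManifold) (hnabla : G.IsLeviCivita nabla)
    {x : M} (u v w : TangentSpace 𝓘(ℝ, V) x) :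
    G.g x (G.covφ nabla x v (G.φ x u)) w - G.g x (G.covφ nabla x u (G.φ x v)) w
      + G.g x (G.covφ nabla x v u) (G.φ x w) - G.g x (G.covφ nabla x u v) (G.φ x w) =
      -(2 * G.g x u (G.φ x v) * ∑ α, G.ε α * G.η α x w) := by
  obtain ⟨X, rfl, hX⟩ := exists_mdifferentiable_extension x u
  obtain ⟨Y, rfl, hY⟩ := exists_mdifferentiable_extension x v
  have hφX := G.mdifferentiableAt_φ hX
  have hφY := G.mdifferentiableAt_φ hY
  have h := congr(G.g x $(hG.normal X Y x hX hY) w)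
  rw [nijenhuis] at h
  simp only [hG.dη_eq _ X Y x hX hY] at h
  -- With every bracket written as a difference of covariant derivatives, the terms in ∇X and ∇Y
  -- cancel and only ∇φ survives.
  rw [← hnabla.torsion_free _ _ x hX hY, ← hnabla.torsion_free _ _ x hφX hφY,
    ← hnabla.torsion_free _ _ x hφX hY, ← hnabla.torsion_free _ _ x hX hφY] at h
  simp only [G.nabla_φ hX, G.nabla_φ hY, map_add, map_sub, map_sum, map_smul, add_apply, sub_apply,
    sum_apply, smul_apply, smul_eq_mul, map_zero, zero_apply, G.g_ξ, G.g_φ_left,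
    ← Finset.mul_sum] at h
  linarith

omit [FiniteDimensional ℝ V] in
-- In the normality equation at (ξ_α, ξ_β) every other term vanishes, as φξ = 0. So [ξ_α, ξ_β] has
-- no component along any n = -φ²n.
theorem IndefiniteMetricGFF.φ_mlieBracket_ξ (hG : G.IsSManifold) (x : M) (α β : Fin r) :
    G.φ x (G.φ x (mlieBracket 𝓘(ℝ, V) (G.ξ α) (G.ξ β) x)) = 0 := by
  have h := hG.normal _ _ x (G.mdifferentiableAt_ξ α x) (G.mdifferentiableAt_ξ β x)
  simp only [hG.dη_eq _ _ _ x (G.mdifferentiableAt_ξ α x) (G.mdifferentiableAt_ξ β x)] at h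
  have e (γ : Fin r) : (fun y ↦ G.φ y (G.ξ γ y)) = 0 := by ext y; exact G.φ_ξ γ y
  rw [nijenhuis, e, e] at h
  simpa [G.φ_ξ] using h

/-- The characteristic fields are Killing on the image of `φ`. -/
theorem IndefiniteMetricGFF.nabla_ξ_φ_symm (hG : G.IsSManifold) (hnabla : G.IsLeviCivita nabla)
    {x : M} (α : Fin r) (u w : TangentSpace 𝓘(ℝ, V) x) :
    G.g x (nabla (G.ξ α) x (G.φ x u)) (G.φ x w) +
      G.g x (nabla (G.ξ α) x (G.φ x w)) (G.φ x u) = 0 := by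
  -- Normality with ξ_α in the second slot leaves the term g((∇_ξ φ)u, φw); the cyclic identity `h2`
  -- expresses it through ∇ξ_α.
  have h1 := G.covφ_normal hG hnabla u (G.ξ α x) w
  have h2 := G.covφ_cyclic hG hnabla (G.ξ α x) u (G.φ x w)
  rw [G.covφ_skew hnabla u (G.φ x w)] at h2
  simp only [G.g_covφ_ξ, G.φ_ξ, map_zero, zero_apply, mul_zero, zero_mul] at h1 h2
  linarith

/-! ### Components along a vector n with η^α(n) = 0 for all α. -/

section Normal

variable {x : M} {n : TangentSpace 𝓘(ℝ, V) x}

/-- Since n = φ(-φn) is in the image of φ, the two numbers have sum zero by `nabla_ξ_φ_symm`. By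
`nabla_ξ_skew` their difference is a multiple of g(n, φ²u) = -g(n, u) = 0. -/
theorem IndefiniteMetricGFF.nabla_ξ_φ_normal (hG : G.IsSManifold) (hnabla : G.IsLeviCivita nabla)
    (hn : ∀ α, G.η α x n = 0) (α : Fin r) {u : TangentSpace 𝓘(ℝ, V) x} (hu : G.g x u n = 0) :
    G.g x (nabla (G.ξ α) x (G.φ x u)) n = 0 ∧ G.g x (nabla (G.ξ α) x n) (G.φ x u) = 0 := by
  have e : G.φ x (-G.φ x n) = n := by rw [map_neg, G.φ_sq]; simp [hn]
  have h1 := G.nabla_ξ_φ_symm hG hnabla α u (-G.φ x n)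
  have h2 := G.nabla_ξ_skew hG hnabla α n (G.φ x u)
  have h3 : G.g x n (G.φ x (G.φ x u)) = 0 := by
    rw [G.φ_sq, map_add, map_neg, G.symm x n u, hu, map_sum]
    simp [G.symm x n (G.ξ _ x), G.g_ξ, hn]
  rw [e] at h1
  rw [h3] at h2
  have h4 := G.ε_sq α
  have h5 : G.g x (nabla (G.ξ α) x n) (G.φ x u) - G.g x (nabla (G.ξ α) x (G.φ x u)) n = 0 := by
    linear_combination G.ε α * h2 -
      (G.g x (nabla (G.ξ α) x n) (G.φ x u) - G.g x (nabla (G.ξ α) x (G.φ x u)) n) * h4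
  constructor <;> linarith

/-- The expression is antisymmetric in α and β because g(ξ_α, ξ_β) is constant, and symmetric
because φ²[ξ_β, ξ_α] = 0. -/
theorem IndefiniteMetricGFF.nabla_ξ_ξ_normal (hG : G.IsSManifold) (hnabla : G.IsLeviCivita nabla)
    (hn : ∀ α, G.η α x n = 0) (α β : Fin r) :
    G.g x (nabla (G.ξ α) x (G.ξ β x)) n = 0 := by
  have hs (α β : Fin r) : G.g x (nabla (G.ξ α) x (G.ξ β x)) n =
      G.g x (nabla (G.ξ α) x n) (G.ξ β x) := by
    have h2 := G.nabla_ξ_skew hG hnabla α n (G.ξ β x)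
    rw [G.φ_ξ, map_zero, mul_zero] at h2
    linear_combination (-G.ε α) * h2 + (G.g x (nabla (G.ξ α) x n) (G.ξ β x) -
      G.g x (nabla (G.ξ α) x (G.ξ β x)) n) * G.ε_sq α
  have h1 := hnabla.metric _ _ x n (G.mdifferentiableAt_ξ α x) (G.mdifferentiableAt_ξ β x)
  have e : (fun y ↦ G.g y (G.ξ α y) (G.ξ β y)) = fun _ ↦ G.ε α * if α = β then 1 else 0 := by
    ext y; rw [G.g_ξ, G.η_ξ]
  rw [e, mvfderiv_const, zero_apply, G.symm x (G.ξ α x), ← hs, ← hs] at h1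
  have h2 := hnabla.torsion_free _ _ x (G.mdifferentiableAt_ξ β x) (G.mdifferentiableAt_ξ α x)
  have h3 : G.g x (mlieBracket 𝓘(ℝ, V) (G.ξ β) (G.ξ α) x) n = 0 := by
    have e : n = -G.φ x (G.φ x n) := by rw [G.φ_sq]; simp [hn]
    rw [e, map_neg, ← G.g_φ_left, ← neg_neg (G.g x (G.φ x _) _), ← G.g_φ_left,
      G.φ_mlieBracket_ξ hG, map_zero, zero_apply, neg_zero]
  rw [← h2, map_sub, sub_apply] at h3
  linarith

/-- Up to characteristic vectors u is -φ(φu), so the two preceding lemmas cover both parts. -/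
theorem IndefiniteMetricGFF.nabla_ξ_normal (hG : G.IsSManifold) (hnabla : G.IsLeviCivita nabla)
    (hn : ∀ α, G.η α x n = 0) (α : Fin r) {u : TangentSpace 𝓘(ℝ, V) x}
    (hu : G.g x (G.φ x u) n = 0) :
    G.g x (nabla (G.ξ α) x u) n = 0 := by
  have h1 := (G.nabla_ξ_φ_normal hG hnabla hn α hu).1
  rw [G.φ_sq, map_add, map_neg, map_sum, map_add, map_sum] at h1
  simp only [map_smul, add_apply, map_neg, neg_apply, sum_apply, smul_apply,
    G.nabla_ξ_ξ_normal hG hnabla hn, smul_zero, Finset.sum_const_zero, add_zero,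
    neg_eq_zero] at h1
  exact h1

/-- `(∇_u φ) v - (∇_v φ) u` is orthogonal to `n` if `u` and `v` are orthogonal to `n` and `φ n`
and `n` is orthogonal to the characteristic vectors. -/
theorem IndefiniteMetricGFF.covφ_normal_symm (hG : G.IsSManifold) (hnabla : G.IsLeviCivita nabla)
    (hn : ∀ α, G.η α x n = 0) {u v : TangentSpace 𝓘(ℝ, V) x}
    (hu : G.g x u n = 0) (hv : G.g x v n = 0) :
    G.g x (G.covφ nabla x v u) n = G.g x (G.covφ nabla x u v) n := by
  have hφn : G.φ x (G.φ x n) = -n := by rw [G.φ_sq]; simp [hn]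
  have hφ (a b : TangentSpace 𝓘(ℝ, V) x) : G.g x (G.covφ nabla x b a) (G.φ x n) +
      G.g x (G.covφ nabla x n a) (G.φ x b) =
      -∑ α, G.η α x b * G.g x (nabla (G.ξ α) x a) n := by
    simp [G.covφ_φ hnabla a b n, hn]
  -- Write A(a; b, w) = g((∇_a φ)b, w), skew in b and w. Normality `h1`, combined with `h2`, `h3`
  -- and the cyclic sums `c1`, `c2`, gives A(n; φu, φv) = A(n; u, v), while `h4` gives the opposite
  -- sign. Hence A(n; u, v) = 0, and `c2` reduces to the claim.
  have h1 := G.covφ_normal hG hnabla u v (G.φ x n)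
  have h2 := hφ (G.φ x u) v
  have h3 := hφ (G.φ x v) u
  have c1 := G.covφ_cyclic hG hnabla n (G.φ x u) (G.φ x v)
  have c2 := G.covφ_cyclic hG hnabla n u v
  have h4 := G.covφ_φ hnabla n u (G.φ x v)
  have h5 (α) := G.covφ_skew hnabla n u (G.ξ α x)
  simp only [hφn, G.η_φ, G.φ_sq x v, map_add, map_neg, map_sum, map_smul,
    smul_eq_mul, mul_zero, G.g_covφ_ξ, Finset.sum_const_zero,
    (G.nabla_ξ_φ_normal hG hnabla hn _ hu).1, (G.nabla_ξ_φ_normal hG hnabla hn _ hv).1,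
    (G.nabla_ξ_φ_normal hG hnabla hn _ hu).2, (G.nabla_ξ_φ_normal hG hnabla hn _ hv).2,
    neg_zero, add_zero] at h1 h2 h3 h4 h5
  simp only [h5, mul_zero, Finset.sum_const_zero, add_zero] at h4
  have s1 := G.covφ_skew hnabla u v n
  have s2 := G.covφ_skew hnabla v u n
  have s3 := G.covφ_skew hnabla (G.φ x u) v n
  have s4 := G.covφ_skew hnabla n u (G.φ x v)
  have s5 := G.covφ_skew hnabla n u v
  have s6 := G.covφ_skew hnabla n (G.φ x u) (G.φ x v)
  have s7 := G.covφ_skew hnabla (G.φ x u) n (G.φ x v)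
  have s8 := G.covφ_skew hnabla u n v
  linarith

end Normal

end Identities

/-! ### Local retractions and extension of fields along an immersion. -/

section AlongImmersion

variable {V : Type*} [NormedAddCommGroup V] [NormedSpace ℝ V]
  {N : Type*} [TopologicalSpace N] [ChartedSpace V N] [IsManifold 𝓘(ℝ, V) ∞ N]
  {V' : Type*} [NormedAddCommGroup V'] [NormedSpace ℝ V']
  {M : Type*} [TopologicalSpace M] [ChartedSpace V' M] [IsManifold 𝓘(ℝ, V') ∞ M]
  {i : M → N}

omit [IsManifold 𝓘(ℝ, V) ∞ N] [IsManifold 𝓘(ℝ, V') ∞ M] in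
/-- An immersion has smooth local left inverses. -/
theorem exists_local_retraction (hi : Manifold.IsImmersion 𝓘(ℝ, V') 𝓘(ℝ, V) ∞ i) (p : M) :
    ∃ (ρ : N → M) (O : Set N), IsOpen O ∧ i p ∈ O ∧
      ContMDiffOn 𝓘(ℝ, V) 𝓘(ℝ, V') ∞ ρ O ∧ ∀ᶠ q in 𝓝 p, ρ (i q) = q := by
  have h := hi.isImmersionAt p
  -- In adapted charts the immersion is v ↦ (v, 0); `ψ` is the projection to the first factor.
  let ψ : V → V' := fun z ↦ (h.equiv.symm z).1
  have hψ : ContDiff ℝ ∞ ψ := contDiff_fst.comp h.equiv.symm.contDiff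
  have hwr (q : M) (hq : q ∈ h.domChart.source) : ψ (h.codChart (i q)) = h.domChart q := by
    have ht : h.domChart q ∈ (h.domChart.extend 𝓘(ℝ, V')).target := by
      simpa using h.domChart.map_source hq
    have h1 := h.writtenInCharts ht
    have h2 : h.codChart (i q) = h.equiv (h.domChart q, 0) := by
      simpa [h.domChart.left_inv hq] using h1
    simp [ψ, h2]
  refine ⟨fun y ↦ h.domChart.symm (ψ (h.codChart y)),
    h.codChart.source ∩ h.codChart ⁻¹' (ψ ⁻¹' h.domChart.target), ?_, ⟨h.mem_codChart_source, ?_⟩,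
    ?_, ?_⟩
  · exact h.codChart.isOpen_inter_preimage (h.domChart.open_target.preimage hψ.continuous)
  · rw [mem_preimage, mem_preimage, hwr p h.mem_domChart_source]
    exact h.domChart.map_source h.mem_domChart_source
  · refine (contMDiffOn_symm_of_mem_maximalAtlas h.domChart_mem_maximalAtlas).comp
      (hψ.contMDiff.comp_contMDiffOn ((contMDiffOn_of_mem_maximalAtlas
        h.codChart_mem_maximalAtlas).mono inter_subset_left)) inter_subset_right
  · filter_upwards [h.domChart.open_source.mem_nhds h.mem_domChart_source] with q hq
    rw [hwr q hq, h.domChart.left_inv hq]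

omit [IsManifold 𝓘(ℝ, V) ∞ N] [IsManifold 𝓘(ℝ, V') ∞ M] in
theorem mfderiv_local_retraction (hi : Manifold.IsImmersion 𝓘(ℝ, V') 𝓘(ℝ, V) ∞ i) {p : M}
    {ρ : N → M} (hρ : MDifferentiableAt 𝓘(ℝ, V) 𝓘(ℝ, V') ρ (i p)) (h : ∀ᶠ q in 𝓝 p, ρ (i q) = q)
    (v : TangentSpace 𝓘(ℝ, V') p) :
    mfderiv 𝓘(ℝ, V) 𝓘(ℝ, V') ρ (i p) (push (V := V) i p v) = v := by
  have h1 : MDifferentiableAt 𝓘(ℝ, V') 𝓘(ℝ, V) i p :=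
    (hi.contMDiff p).mdifferentiableAt (by simp)
  have h2 := mfderiv_comp_apply p hρ h1 v
  have h3 : ρ ∘ i =ᶠ[𝓝 p] id := h
  have h4 := congr($(h3.mfderiv_eq (I := 𝓘(ℝ, V')) (I' := 𝓘(ℝ, V'))) v)
  rw [mfderiv_id] at h4
  exact h2.symm.trans h4

omit [IsManifold 𝓘(ℝ, V) ∞ N] [IsManifold 𝓘(ℝ, V') ∞ M] in
theorem push_injective (hi : Manifold.IsImmersion 𝓘(ℝ, V') 𝓘(ℝ, V) ∞ i) (p : M) :
    Function.Injective (push (V := V) (V' := V') i p) := by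
  obtain ⟨ρ, O, hO, hp, hρ, h⟩ := exists_local_retraction hi p
  refine Function.LeftInverse.injective fun v ↦ mfderiv_local_retraction hi ?_ h v
  exact (hρ.contMDiffAt (hO.mem_nhds hp)).mdifferentiableAt (by simp)

omit [IsManifold 𝓘(ℝ, V) ∞ N] [IsManifold 𝓘(ℝ, V') ∞ M] in
theorem lift_push (hi : Manifold.IsImmersion 𝓘(ℝ, V') 𝓘(ℝ, V) ∞ i) (p : M)
    (v : TangentSpace 𝓘(ℝ, V') p) : lift i p (push (V := V) i p v) = v :=
  Function.leftInverse_invFun (push_injective hi p) v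

omit [IsManifold 𝓘(ℝ, V) ∞ N] [IsManifold 𝓘(ℝ, V') ∞ M] in
theorem push_lift {p : M} {w : TangentSpace 𝓘(ℝ, V) (i p)}
    (hw : w ∈ tangentImage (V' := V') i p) : push i p (lift (V' := V') i p w) = w :=
  Function.invFun_eq (f := push (V := V) (V' := V') i p) hw

omit [IsManifold 𝓘(ℝ, V') ∞ M] in
/-- A field along an immersion extends locally to a field on the ambient manifold. -/
theorem exists_extension_along (hi : Manifold.IsImmersion 𝓘(ℝ, V') 𝓘(ℝ, V) ∞ i) {p : M}
    {W : Π q : M, TangentSpace 𝓘(ℝ, V) (i q)}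
    (hW : MDifferentiableAt 𝓘(ℝ, V') 𝓘(ℝ, V).tangent
      (fun q ↦ (⟨i q, W q⟩ : TangentBundle 𝓘(ℝ, V) N)) p) :
    ∃ Z : Π y : N, TangentSpace 𝓘(ℝ, V) y, MDiffAt (T% Z) (i p) ∧
      ∀ᶠ q in 𝓝 p, Z (i q) = W q := by
  obtain ⟨ρ, O, hO, hp, hρ, h⟩ := exists_local_retraction hi p
  have hρp : MDiffAt ρ (i p) :=
    (hρ.contMDiffAt (hO.mem_nhds hp)).mdifferentiableAt (by simp)
  let e := trivializationAt V (TangentSpace 𝓘(ℝ, V) : N → Type _) (i p)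
  have hpe : i p ∈ e.baseSet := FiberBundle.mem_baseSet_trivializationAt' (i p)
  let w : M → V := fun q ↦ (e ⟨i q, W q⟩).2
  have hw : MDifferentiableAt 𝓘(ℝ, V') 𝓘(ℝ, V) w p := ((mdifferentiableAt_totalSpace ..).1 hW).2
  -- The fibre coordinate of W in one fixed trivialization is carried to the ambient manifold by ρ.
  refine ⟨fun y ↦ e.symm y (w (ρ y)), ?_, ?_⟩
  · rw [e.mdifferentiableAt_section_iff _ _ hpe]
    have h1 : MDiffAt (w ∘ ρ) (i p) := by
      refine MDifferentiableAt.comp (i p) ?_ hρp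
      rwa [h.self_of_nhds]
    refine h1.congr_of_eventuallyEq ?_
    filter_upwards [e.open_baseSet.mem_nhds hpe] with y hy
    simp [e.apply_mk_symm hy]
  · filter_upwards [h, (hi.contMDiff p).continuousAt.eventually_mem
      (e.open_baseSet.mem_nhds hpe)] with q hq hqe
    simp only [hq, w]
    exact e.symm_apply_apply_mk hqe _

end AlongImmersion

/-! ### The covariant derivative along a map, computed by an extension. -/

section CovAlong

variable {V : Type*} [NormedAddCommGroup V] [NormedSpace ℝ V] [FiniteDimensional ℝ V]
  {N : Type*} [TopologicalSpace N] [ChartedSpace V N] [IsManifold 𝓘(ℝ, V) ∞ N]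
  {V' : Type*} [NormedAddCommGroup V'] [NormedSpace ℝ V']
  {M : Type*} [TopologicalSpace M] [ChartedSpace V' M]
  {nabla : CovariantDerivative 𝓘(ℝ, V) V (TangentSpace 𝓘(ℝ, V) : N → Type _)}

omit [FiniteDimensional ℝ V] in
theorem mdifferentiableAt_finsetSum_section {ι : Type*} (s : Finset ι)
    {σ : ι → Π y : N, TangentSpace 𝓘(ℝ, V) y} {x : N} (h : ∀ k, MDiffAt (T% (σ k)) x) :
    MDiffAt (T% (∑ k ∈ s, σ k)) x ∧ nabla (∑ k ∈ s, σ k) x = ∑ k ∈ s, nabla (σ k) x := by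
  classical
  induction s using Finset.induction_on with
  | empty =>
    refine ⟨?_, by simp⟩
    rw [Finset.sum_empty]
    exact mdifferentiableAt_zeroSection ..
  | insert a s ha ih =>
    rw [Finset.sum_insert ha, Finset.sum_insert ha, ← ih.2]
    exact ⟨mdifferentiableAt_add_section (h a) ih.1,
      nabla.isCovariantDerivativeOnUniv.add (h a) ih.1⟩

/-- The covariant derivative along a map of the restriction of a field. -/
theorem covAlong_eq {i : M → N} {p : M}
    (hi : MDifferentiableAt 𝓘(ℝ, V') 𝓘(ℝ, V) i p)
    {W : Π q : M, TangentSpace 𝓘(ℝ, V) (i q)} {Z : Π y : N, TangentSpace 𝓘(ℝ, V) y}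
    (hZ : MDiffAt (T% Z) (i p)) (h : ∀ᶠ q in 𝓝 p, Z (i q) = W q) (v : TangentSpace 𝓘(ℝ, V') p) :
    covAlong nabla i W p v = nabla Z (i p) (push i p v) := by
  let e := trivializationAt V (TangentSpace 𝓘(ℝ, V) : N → Type _) (i p)
  let b := Module.finBasis ℝ V
  have hpe : i p ∈ e.baseSet := FiberBundle.mem_baseSet_trivializationAt' (i p)
  let f (k) : N → ℝ := LinearMap.piApply (e.localFrameCoeff 𝓘(ℝ, V) b k) Z
  have hf (k) : MDiffAt (f k) (i p) := mdifferentiableAt_localFrameCoeff b hpe hZ k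
  have he (k) : MDiffAt (T% (e.localFrame b k)) (i p) :=
    (contMDiffAt_localFrame_of_mem ∞ e b k hpe).mdifferentiableAt (by simp)
  have hfe (k) : MDiffAt (T% (f k • e.localFrame b k)) (i p) :=
    MDifferentiableAt.smul_section (hf k) (he k)
  have hsum := mdifferentiableAt_finsetSum_section (nabla := nabla) Finset.univ hfe
  -- Near `i p` the field Z is its expansion in the frame used by `covAlong`; the Leibniz rule then
  -- produces the defining sum.
  have hev : ∀ᶠ y in 𝓝 (i p), Z y = (∑ k, f k • e.localFrame b k) y := by
    filter_upwards [e.eventually_eq_localFrame_sum_coeff_smul (I := 𝓘(ℝ, V)) (s := Z) b hpe]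
      with y hy
    rw [hy, Finset.sum_apply]
    rfl
  rw [nabla.isCovariantDerivativeOnUniv.congr_of_eventuallyEq hZ hsum.1 Filter.univ_mem hev,
    hsum.2, sum_apply]
  refine Finset.sum_congr rfl fun k _ ↦ ?_
  rw [nabla.isCovariantDerivativeOnUniv.leibniz (he k) (hf k)]
  have h1 : mvfderiv 𝓘(ℝ, V') (fun q ↦ e.localFrameCoeff 𝓘(ℝ, V) b k (i q) (W q)) p v =
      mvfderiv 𝓘(ℝ, V) (f k) (i p) (push i p v) := by
    have : (fun q ↦ e.localFrameCoeff 𝓘(ℝ, V) b k (i q) (W q)) =ᶠ[𝓝 p] f k ∘ i := by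
      filter_upwards [h] with q hq
      simp [f, hq]
    rw [mvfderiv_congr this]
    exact mfderiv_comp_apply p (hf k) hi v
  have h2 : e.localFrameCoeff 𝓘(ℝ, V) b k (i p) (W p) = f k (i p) := by
    simp [f, h.self_of_nhds]
  rw [h1, h2]
  simp [add_comm]
  rfl

end CovAlong

/-! ### Brackets of fields related by a smooth map. -/

section Bracket

variable {V : Type*} [NormedAddCommGroup V] [NormedSpace ℝ V] [CompleteSpace V]
  {N : Type*} [TopologicalSpace N] [ChartedSpace V N] [IsManifold 𝓘(ℝ, V) ∞ N]
  {V' : Type*} [NormedAddCommGroup V'] [NormedSpace ℝ V'] [CompleteSpace V']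
  {M : Type*} [TopologicalSpace M] [ChartedSpace V' M] [IsManifold 𝓘(ℝ, V') ∞ M]
  {i : M → N}

/-- Brackets of related vector fields are related. -/
theorem mlieBracket_eq_push (hi : ContMDiff 𝓘(ℝ, V') 𝓘(ℝ, V) ∞ i) {p : M}
    {X Y : Π q : M, TangentSpace 𝓘(ℝ, V') q} (hX : MDiffAt (T% X) p) (hY : MDiffAt (T% Y) p)
    {X' Y' : Π y : N, TangentSpace 𝓘(ℝ, V) y} (hX' : MDiffAt (T% X') (i p))
    (hY' : MDiffAt (T% Y') (i p)) (hXX' : ∀ᶠ q in 𝓝 p, X' (i q) = push i q (X q))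
    (hYY' : ∀ᶠ q in 𝓝 p, Y' (i q) = push i q (Y q)) :
    mlieBracket 𝓘(ℝ, V) X' Y' (i p) = push i p (mlieBracket 𝓘(ℝ, V') X Y p) := by
  have le2 : (2 : ℕ∞ω) ≤ ∞ := ENat.LEInfty.out
  have i1 : IsManifold 𝓘(ℝ, V) 1 N := inferInstance
  -- Both brackets are tested on this single V-valued function: its derivative at `i p` is the
  -- identity, so it separates vectors there.
  let f : N → V := extChartAt 𝓘(ℝ, V) (i p)
  have hf : ContMDiffAt 𝓘(ℝ, V) 𝓘(ℝ, V) 2 f (i p) :=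
    (contMDiffAt_extChartAt (n := ∞)).of_le le2
  have hi2 : ContMDiffAt 𝓘(ℝ, V') 𝓘(ℝ, V) 2 i p := (hi p).of_le le2
  have hdi (q : M) : MDifferentiableAt 𝓘(ℝ, V') 𝓘(ℝ, V) i q := (hi q).mdifferentiableAt (by simp)
  have hfi : ContMDiffAt 𝓘(ℝ, V') 𝓘(ℝ, V) 2 (f ∘ i) p := hf.comp p hi2
  have hfd : ∀ᶠ q in 𝓝 p, MDiffAt f (i q) := by
    filter_upwards [hi.continuous.continuousAt.eventually
      ((contMDiffAt_iff_contMDiffAt_nhds (by simp)).1 hf)] with q hq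
    exact hq.mdifferentiableAt (by simp)
  have hcomp (q : M) (hq : MDiffAt f (i q)) (v : TangentSpace 𝓘(ℝ, V') q) :
      mvfderiv 𝓘(ℝ, V') (f ∘ i) q v = mvfderiv 𝓘(ℝ, V) f (i q) (push i q v) :=
    mfderiv_comp_apply q hq (hdi q) v
  have key {Z : Π q : M, TangentSpace 𝓘(ℝ, V') q} {Z' : Π y : N, TangentSpace 𝓘(ℝ, V) y}
      (hZ' : MDiffAt (T% Z') (i p)) (hZZ' : ∀ᶠ q in 𝓝 p, Z' (i q) = push i q (Z q))
      (v : TangentSpace 𝓘(ℝ, V') p) :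
      mvfderiv 𝓘(ℝ, V') (fun q ↦ mvfderiv 𝓘(ℝ, V') (f ∘ i) q (Z q)) p v =
        mvfderiv 𝓘(ℝ, V) (fun y ↦ mvfderiv 𝓘(ℝ, V) f y (Z' y)) (i p) (push i p v) := by
    have : (fun q ↦ mvfderiv 𝓘(ℝ, V') (f ∘ i) q (Z q)) =ᶠ[𝓝 p]
        (fun y ↦ mvfderiv 𝓘(ℝ, V) f y (Z' y)) ∘ i := by
      filter_upwards [hfd, hZZ'] with q hq hqZ
      rw [hcomp q hq, Function.comp_apply, hqZ]
    rw [mvfderiv_congr this]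
    exact mfderiv_comp_apply p (mvfderiv_mlieBracket hf hX' hZ').1 (hdi p) v
  have h1 := (mvfderiv_mlieBracket hf hX' hY').2
  have h2 := (mvfderiv_mlieBracket hfi hX hY).2
  rw [key hY' hYY', key hX' hXX', hcomp p hfd.self_of_nhds, ← hXX'.self_of_nhds,
    ← hYY'.self_of_nhds, ← h1] at h2
  have hid (v : TangentSpace 𝓘(ℝ, V) (i p)) : mvfderiv 𝓘(ℝ, V) f (i p) v = v :=
    congr($(mfderiv_extChartAt_self (I := 𝓘(ℝ, V)) (x := i p)) v)
  exact ((hid _).symm.trans h2.symm).trans (hid _)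

end Bracket

/-! ### Smoothness of fields along an immersion. -/

section Smoothness

variable {V : Type*} [NormedAddCommGroup V] [NormedSpace ℝ V]
  {N : Type*} [TopologicalSpace N] [ChartedSpace V N] [IsManifold 𝓘(ℝ, V) ∞ N]
  {V' : Type*} [NormedAddCommGroup V'] [NormedSpace ℝ V']
  {M : Type*} [TopologicalSpace M] [ChartedSpace V' M] [IsManifold 𝓘(ℝ, V') ∞ M]
  {i : M → N}

theorem contMDiffOn_push (hi : ContMDiff 𝓘(ℝ, V') 𝓘(ℝ, V) ∞ i) {U : Set M}
    {X : Π q : M, TangentSpace 𝓘(ℝ, V') q}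
    (hX : ContMDiffOn 𝓘(ℝ, V') 𝓘(ℝ, V').tangent ∞
      (fun q ↦ (⟨q, X q⟩ : TangentBundle 𝓘(ℝ, V') M)) U) :
    ContMDiffOn 𝓘(ℝ, V') 𝓘(ℝ, V).tangent ∞
      (fun q ↦ (⟨i q, push i q (X q)⟩ : TangentBundle 𝓘(ℝ, V) N)) U :=
  (hi.contMDiff_tangentMap (m := ∞) (by simp)).comp_contMDiffOn hX

omit [IsManifold 𝓘(ℝ, V') ∞ M] in
theorem IndefiniteMetricGFF.contMDiffOn_φ_along {r : ℕ} (G : IndefiniteMetricGFF V N r)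
    (hi : ContMDiff 𝓘(ℝ, V') 𝓘(ℝ, V) ∞ i) {U : Set M} {W : Π q : M, TangentSpace 𝓘(ℝ, V) (i q)}
    (hW : ContMDiffOn 𝓘(ℝ, V') 𝓘(ℝ, V).tangent ∞
      (fun q ↦ (⟨i q, W q⟩ : TangentBundle 𝓘(ℝ, V) N)) U) :
    ContMDiffOn 𝓘(ℝ, V') 𝓘(ℝ, V).tangent ∞
      (fun q ↦ (⟨i q, G.φ (i q) (W q)⟩ : TangentBundle 𝓘(ℝ, V) N)) U :=
  ContMDiffOn.clm_bundle_apply (F₁ := V) (F₂ := V) (b := i)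
    (G.φ_contMDiff.comp_contMDiffOn hi.contMDiffOn) hW

/-- A smooth field along an immersion which is tangent to `M` is a smooth field on `M`. -/
theorem contMDiffOn_of_push (hi : Manifold.IsImmersion 𝓘(ℝ, V') 𝓘(ℝ, V) ∞ i) {U : Set M}
    (hU : IsOpen U) {W : Π q : M, TangentSpace 𝓘(ℝ, V) (i q)}
    (hW : ContMDiffOn 𝓘(ℝ, V') 𝓘(ℝ, V).tangent ∞
      (fun q ↦ (⟨i q, W q⟩ : TangentBundle 𝓘(ℝ, V) N)) U)
    {X : Π q : M, TangentSpace 𝓘(ℝ, V') q} (hX : ∀ q ∈ U, push i q (X q) = W q) :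
    ContMDiffOn 𝓘(ℝ, V') 𝓘(ℝ, V').tangent ∞
      (fun q ↦ (⟨q, X q⟩ : TangentBundle 𝓘(ℝ, V') M)) U := by
  intro p hp
  refine ContMDiffAt.contMDiffWithinAt ?_
  obtain ⟨ρ, O, hO, hpO, hρ, h⟩ := exists_local_retraction hi p
  -- X is locally the image of W under the tangent map of the retraction, hence smooth.
  have hT : ContMDiffAt 𝓘(ℝ, V).tangent 𝓘(ℝ, V').tangent ∞
      (tangentMapWithin 𝓘(ℝ, V) 𝓘(ℝ, V') ρ O) ⟨i p, W p⟩ :=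
    (hρ.contMDiffOn_tangentMapWithin (m := ∞) (by simp) hO.uniqueMDiffOn).contMDiffAt
      ((hO.preimage (FiberBundle.continuous_proj V (TangentSpace 𝓘(ℝ, V) : N → Type _))).mem_nhds
        hpO)
  have h1 := hT.comp p (hW.contMDiffAt (hU.mem_nhds hp))
  refine h1.congr_of_eventuallyEq ?_
  filter_upwards [h.eventually_nhds, hU.mem_nhds hp,
    (hi.contMDiff p).continuousAt.eventually_mem (hO.mem_nhds hpO)] with q hq hqU hqO
  have h2 : MDifferentiableAt 𝓘(ℝ, V) 𝓘(ℝ, V') ρ (i q) :=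
    (hρ.contMDiffAt (hO.mem_nhds hqO)).mdifferentiableAt (by simp)
  have h3 := mfderiv_local_retraction hi h2 hq (X q)
  rw [hX q hqU, ← mfderivWithin_of_mem_nhds (hO.mem_nhds hqO)] at h3
  have h4 := hq.self_of_nhds
  simp only [Function.comp_apply, tangentMapWithin]
  refine TotalSpace.ext h4.symm ?_
  exact heq_of_eq h3.symm

end Smoothness

/-! ### Linear algebra of the splitting of the ambient tangent space. -/

theorem component_add {W : Type*} [AddCommGroup W] [Module ℝ W] {A B : Submodule ℝ W}
    (h : IsCompl A B) {a b : W} (ha : a ∈ A) (hb : b ∈ B) : component A B (a + b) = a := by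
  rw [component, dif_pos h, map_add, (Submodule.projection_eq_self_iff h a).2 ha,
    (Submodule.projection_apply_eq_zero_iff h).2 hb, add_zero]

theorem eq_ker_of_le_of_finrank {W : Type*} [AddCommGroup W] [Module ℝ W] [FiniteDimensional ℝ W]
    {A : Submodule ℝ W} {f : W →ₗ[ℝ] ℝ} (hf : f ≠ 0) (hle : A ≤ LinearMap.ker f)
    (hA : Module.finrank ℝ W = Module.finrank ℝ A + 1) : A = LinearMap.ker f := by
  refine Submodule.eq_of_le_of_finrank_eq hle ?_
  have h1 := Module.Dual.finrank_ker_add_one_of_ne_zero (f := f) hf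
  omega

namespace CharLightlikeHypersurface

variable {V : Type*} [NormedAddCommGroup V] [NormedSpace ℝ V] [FiniteDimensional ℝ V]
  {N : Type*} [TopologicalSpace N] [ChartedSpace V N] [IsManifold 𝓘(ℝ, V) ∞ N]
  {V' : Type*} [NormedAddCommGroup V'] [NormedSpace ℝ V']
  {M : Type*} [TopologicalSpace M] [ChartedSpace V' M] [IsManifold 𝓘(ℝ, V') ∞ M]
  {r : ℕ} {G : IndefiniteMetricGFF V N r} (L : CharLightlikeHypersurface V' M G)
  {p : M} {e : TangentSpace 𝓘(ℝ, V') p} {n : TangentSpace 𝓘(ℝ, V) (L.i p)}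

omit [FiniteDimensional ℝ V] in
theorem exists_smul_eq_of_mem_Rad (he : e ∈ L.Rad p) (he0 : e ≠ 0) {v : TangentSpace 𝓘(ℝ, V') p}
    (hv : v ∈ L.Rad p) : ∃ c : ℝ, c • e = v := by
  have h := (finrank_eq_one_iff_of_nonzero' (K := ℝ) (V := L.Rad p) ⟨e, he⟩ (by
    simpa [Subtype.ext_iff] using he0)).1 (L.lightlike p) ⟨v, hv⟩
  obtain ⟨c, hc⟩ := h
  exact ⟨c, congrArg Subtype.val hc⟩

omit [FiniteDimensional ℝ V] in
variable {L} in
theorem IsTransversal.ne_zero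
    (hn : L.IsTransversal p e n) : e ≠ 0 := by
  rintro rfl
  simpa using hn.1

/-- The image of T_pM lies in the orthogonal complement of the radical vector, and both are
hyperplanes: one by the codimension, the other by nondegeneracy. -/
theorem mem_tangentImage_iff (he : e ∈ L.Rad p) (he0 : e ≠ 0)
    (w : TangentSpace 𝓘(ℝ, V) (L.i p)) :
    w ∈ tangentImage (V' := V') L.i p ↔ G.g (L.i p) w (push L.i p e) = 0 := by
  have hinj := push_injective L.immersion p
  have hfd : FiniteDimensional ℝ (TangentSpace 𝓘(ℝ, V) (L.i p)) :=
    inferInstanceAs (FiniteDimensional ℝ V)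
  have hf0 : (G.g (L.i p) (push L.i p e)).toLinearMap ≠ 0 := fun h0 ↦
    he0 <| (map_eq_zero_iff _ hinj).1 <| G.nondegenerate _ _ fun w ↦ congr($h0 w)
  have hle : tangentImage (V' := V') L.i p ≤
      LinearMap.ker (G.g (L.i p) (push L.i p e)).toLinearMap := by
    rintro _ ⟨v, rfl⟩
    exact he v
  have hfin : Module.finrank ℝ (tangentImage (V' := V') L.i p) = Module.finrank ℝ V' :=
    LinearMap.finrank_range_of_inj hinj
  rw [eq_ker_of_le_of_finrank hf0 hle (by rw [hfin]; exact L.codim), G.symm]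
  rfl

omit [FiniteDimensional ℝ V] in
theorem mem_S_iff (he : e ∈ L.Rad p) (hn : L.IsTransversal p e n)
    (v : TangentSpace 𝓘(ℝ, V') p) : v ∈ L.S p ↔ G.g (L.i p) n (push L.i p v) = 0 := by
  refine ⟨hn.2.2 v, fun h ↦ ?_⟩
  obtain ⟨a, ha, s, hs, rfl⟩ := Submodule.mem_sup.1 ((L.S_compl p).sup_eq_top ▸
    Submodule.mem_top : v ∈ _)
  obtain ⟨c, rfl⟩ := L.exists_smul_eq_of_mem_Rad he hn.ne_zero ha
  have h2 := hn.2.2 s hs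
  simp only [map_add, map_smul, h2, hn.1, smul_eq_mul, mul_one, add_zero] at h
  simpa [h] using hs

omit [FiniteDimensional ℝ V] in
theorem η_push_of_mem_Rad (he : e ∈ L.Rad p) (α : Fin r) : G.η α (L.i p) (push L.i p e) = 0 := by
  obtain ⟨v, hv⟩ := L.ξ_tangent α p
  have h1 := G.g_ξ α (L.i p) (push L.i p e)
  have h2 : G.g (L.i p) (push L.i p e) (G.ξ α (L.i p)) = 0 := by
    rw [← hv]; exact he v
  rw [G.symm, h2] at h1
  rcases mul_eq_zero.1 h1.symm with h | h
  · simpa [h] using G.ε_sq α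
  · exact h

omit [FiniteDimensional ℝ V] in
theorem η_of_isTransversal (hn : L.IsTransversal p e n) (α : Fin r) : G.η α (L.i p) n = 0 := by
  obtain ⟨v, hvS, hv⟩ := L.ker_φ_le p _ (G.φ_ξ α (L.i p))
  have h1 := G.g_ξ α (L.i p) n
  have h2 : G.g (L.i p) n (G.ξ α (L.i p)) = 0 := by
    rw [← hv]; exact hn.2.2 v hvS
  rw [G.symm, h2] at h1
  rcases mul_eq_zero.1 h1.symm with h | h
  · simpa [h] using G.ε_sq α
  · exact h

theorem ltr_eq_span (he : e ∈ L.Rad p) (hn : L.IsTransversal p e n) :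
    L.ltr p = Submodule.span ℝ {n} := by
  refine le_antisymm (Submodule.span_le.2 ?_) (Submodule.span_mono ?_)
  · rintro n' ⟨e', he', hn'⟩
    obtain ⟨c, rfl⟩ := L.exists_smul_eq_of_mem_Rad he hn.ne_zero he'
    have hc : c * G.g (L.i p) n' (push L.i p e) = 1 := by simpa using hn'.1
    have hc0 : c ≠ 0 := left_ne_zero_of_mul_eq_one hc
    have hd : c • n' - n ∈ tangentImage (V' := V') L.i p := by
      rw [L.mem_tangentImage_iff he hn.ne_zero]
      simp [hc, hn.1]
    obtain ⟨v, hv⟩ := hd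
    replace hv : push L.i p v = c • n' - n := hv
    -- The difference `c • n' - n` is tangent and orthogonal to the screen, hence radical: `c • n' =
    -- n + a • e`. As both n and n' are null, 2a = 0.
    have hvR : v ∈ L.Rad p := by
      intro w
      obtain ⟨a, ha, s, hs, rfl⟩ := Submodule.mem_sup.1 ((L.S_compl p).sup_eq_top ▸
        Submodule.mem_top : w ∈ _)
      have h1 := ha v
      rw [G.symm] at h1
      rw [map_add, map_add, h1, hv]
      simp [hn.2.2 s hs, hn'.2.2 s hs]
    obtain ⟨a, rfl⟩ := L.exists_smul_eq_of_mem_Rad he hn.ne_zero hvR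
    have h2 : c • n' = n + a • push L.i p e := by rw [← map_smul, hv]; abel
    have h3 : G.g (L.i p) (c • n') (c • n') = 0 := by simp [hn'.2.1]
    have h4 : G.g (L.i p) (push L.i p e) n = 1 := by rw [G.symm, hn.1]
    have h5 : G.g (L.i p) (push L.i p e) (push L.i p e) = 0 := he e
    rw [h2] at h3
    simp only [map_add, map_smul, add_apply, smul_apply, hn.1, hn.2.1, h4, h5,
      smul_eq_mul] at h3
    have ha : a = 0 := by linarith
    rw [ha, zero_smul, add_zero] at h2
    refine Submodule.mem_span_singleton.2 ⟨c⁻¹, ?_⟩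
    rw [← h2, smul_smul, inv_mul_cancel₀ hc0, one_smul]
  · rintro _ rfl
    exact ⟨e, he, hn⟩

theorem isCompl_tangentImage_ltr (he : e ∈ L.Rad p) (hn : L.IsTransversal p e n) :
    IsCompl (tangentImage (V' := V') L.i p) (L.ltr p) := by
  rw [L.ltr_eq_span he hn]
  refine ⟨Submodule.disjoint_def.2 fun w hw hwn ↦ ?_, codisjoint_iff.2 (eq_top_iff.2 fun w _ ↦ ?_)⟩
  · obtain ⟨c, rfl⟩ := Submodule.mem_span_singleton.1 hwn
    rw [L.mem_tangentImage_iff he hn.ne_zero] at hw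
    have : c = 0 := by simpa [hn.1] using hw
    simp [this]
  · refine Submodule.mem_sup.2 ⟨w - G.g (L.i p) w (push L.i p e) • n, ?_, _,
      Submodule.smul_mem _ _ (Submodule.mem_span_singleton_self n), sub_add_cancel _ _⟩
    rw [L.mem_tangentImage_iff he hn.ne_zero]
    simp [hn.1]

/-- Decomposition of an ambient tangent vector. -/
theorem exists_decomposition (he : e ∈ L.Rad p) (hn : L.IsTransversal p e n)
    (w : TangentSpace 𝓘(ℝ, V) (L.i p)) :
    ∃ (c a : ℝ) (s : TangentSpace 𝓘(ℝ, V') p), s ∈ L.S p ∧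
      w = push L.i p (a • e + s) + c • n := by
  obtain ⟨_, ⟨t, rfl⟩, m, hm, rfl⟩ := Submodule.mem_sup.1
    ((L.isCompl_tangentImage_ltr he hn).sup_eq_top ▸ Submodule.mem_top : w ∈ _)
  rw [L.ltr_eq_span he hn] at hm
  obtain ⟨c, rfl⟩ := Submodule.mem_span_singleton.1 hm
  obtain ⟨a, ha, s, hs, rfl⟩ := Submodule.mem_sup.1 ((L.S_compl p).sup_eq_top ▸
    Submodule.mem_top : t ∈ _)
  obtain ⟨a, rfl⟩ := L.exists_smul_eq_of_mem_Rad he hn.ne_zero ha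
  exact ⟨c, a, s, hs, rfl⟩

section SecondFundamentalForms

variable (nabla : CovariantDerivative 𝓘(ℝ, V) V (TangentSpace 𝓘(ℝ, V) : N → Type _))

/-- The tangential part of ∇̄_X Y is orthogonal to E, so no projection is needed. -/
theorem B_eq {E : Π p : M, TangentSpace 𝓘(ℝ, V') p} (he : E p ∈ L.Rad p)
    (hn : L.IsTransversal p (E p) n) (X Y : Π p : M, TangentSpace 𝓘(ℝ, V') p) :
    L.B nabla E X Y p = G.g (L.i p) (L.ambientCov nabla X Y p) (push L.i p (E p)) := by
  obtain ⟨c, a, s, hs, hw⟩ := L.exists_decomposition he hn (L.ambientCov nabla X Y p)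
  have hc := (L.isCompl_tangentImage_ltr he hn).symm
  have hmem : c • n ∈ L.ltr p := by
    rw [L.ltr_eq_span he hn]
    exact Submodule.smul_mem _ _ (Submodule.mem_span_singleton_self n)
  have ht : push (V := V) L.i p (a • E p + s) ∈ tangentImage (V' := V') L.i p := ⟨_, rfl⟩
  have h0 := (L.mem_tangentImage_iff he hn.ne_zero _).1 ht
  unfold B CharLightlikeHypersurface.h
  rw [hw, add_comm, component_add hc hmem ht, map_add, add_apply, h0, add_zero]

/-- Pairing with N kills the screen part and the part along N, leaving exactly the radical
component. -/
theorem C_eq {ν : Π q : M, TangentSpace 𝓘(ℝ, V) (L.i q)} (he : e ∈ L.Rad p)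
    (hn : L.IsTransversal p e (ν p)) (X Y : Π p : M, TangentSpace 𝓘(ℝ, V') p) :
    L.C nabla ν X Y p = G.g (L.i p) (L.ambientCov nabla X Y p) (ν p) := by
  obtain ⟨c, a, s, hs, hw⟩ := L.exists_decomposition he hn (L.ambientCov nabla X Y p)
  have hc := L.isCompl_tangentImage_ltr he hn
  have hmem : c • ν p ∈ L.ltr p := by
    rw [L.ltr_eq_span he hn]
    exact Submodule.smul_mem _ _ (Submodule.mem_span_singleton_self _)
  have ht : push (V := V) L.i p (a • e + s) ∈ tangentImage (V' := V') L.i p := ⟨_, rfl⟩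
  have hI : L.inducedCov nabla X Y p = a • e + s := by
    unfold inducedCov
    rw [hw, component_add hc ht hmem]
    exact lift_push L.immersion p _
  unfold C hStar
  rw [ hI, Rad, component_add (L.S_compl p) (Submodule.smul_mem _ _ he) hs, hw, G.symm,
    G.symm _ _ (ν p)]
  simp [hn.2.1, hn.2.2 s hs]

end SecondFundamentalForms

theorem φ_push_mem_tangentImage (he : e ∈ L.Rad p) (he0 : e ≠ 0) {v : TangentSpace 𝓘(ℝ, V') p}
    (hv : v ∈ L.D₀ p) : G.φ (L.i p) (push L.i p v) ∈ tangentImage (V' := V') L.i p := by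
  rw [L.mem_tangentImage_iff he he0, G.g_φ_left, hv.2.1 e he, neg_zero]

theorem push_φTan {X : Π p : M, TangentSpace 𝓘(ℝ, V') p} (he : e ∈ L.Rad p) (he0 : e ≠ 0)
    (hX : X p ∈ L.D₀ p) : push L.i p (L.φTan X p) = G.φ (L.i p) (push L.i p (X p)) :=
  push_lift (L.φ_push_mem_tangentImage he he0 hX)

omit [FiniteDimensional ℝ V] in
theorem isTransversal_mem_ltr (he : e ∈ L.Rad p) (hn : L.IsTransversal p e n) : n ∈ L.ltr p :=
  Submodule.subset_span ⟨e, he, hn⟩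

/-- Applying φ exchanges two defining conditions: X ⊥ φN gives φX ∈ S(TM), and X ∈ S(TM) gives φX ⊥
φN. Orthogonality to φE comes from X ⊥ E. -/
theorem φTan_mem_D₀ {X : Π p : M, TangentSpace 𝓘(ℝ, V') p} (he : e ∈ L.Rad p)
    (hn : L.IsTransversal p e n) (hX : X p ∈ L.D₀ p) : L.φTan X p ∈ L.D₀ p := by
  have hp := L.push_φTan he hn.ne_zero hX
  refine ⟨?_, fun e' he' ↦ ?_, fun n' hn' ↦ ?_⟩
  · rw [L.mem_S_iff he hn, hp, G.symm, G.g_φ_left, hX.2.2 n (L.isTransversal_mem_ltr he hn),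
      neg_zero]
  · rw [hp, G.compat, G.symm, he' (X p)]
    simp [L.η_push_of_mem_Rad he']
  · rw [L.ltr_eq_span he hn] at hn'
    obtain ⟨c, rfl⟩ := Submodule.mem_span_singleton.1 hn'
    rw [hp, map_smul, map_smul, G.compat, G.symm, hn.2.2 _ hX.1]
    simp [L.η_of_isTransversal hn]

end CharLightlikeHypersurface

/-! ### Integrability and the action of φ on the second fundamental forms. -/

namespace CharLightlikeHypersurface

variable {V : Type*} [NormedAddCommGroup V] [NormedSpace ℝ V] [FiniteDimensional ℝ V]
  {N : Type*} [TopologicalSpace N] [ChartedSpace V N] [IsManifold 𝓘(ℝ, V) ∞ N]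
  {V' : Type*} [NormedAddCommGroup V'] [NormedSpace ℝ V']
  {M : Type*} [TopologicalSpace M] [ChartedSpace V' M] [IsManifold 𝓘(ℝ, V') ∞ M]
  {r : ℕ} {G : IndefiniteMetricGFF V N r} (L : CharLightlikeHypersurface V' M G)
  {nabla : CovariantDerivative 𝓘(ℝ, V) V (TangentSpace 𝓘(ℝ, V) : N → Type _)}
  {U : Set M} {p : M}

omit [FiniteDimensional ℝ V] in
theorem mdifferentiableAt_i (p : M) : MDifferentiableAt 𝓘(ℝ, V') 𝓘(ℝ, V) L.i p :=
  (L.immersion.contMDiff p).mdifferentiableAt (by simp)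

omit [FiniteDimensional ℝ V] in
theorem exists_extension {D : Π p : M, Submodule ℝ (TangentSpace 𝓘(ℝ, V') p)} (hU : IsOpen U)
    {X : Π p : M, TangentSpace 𝓘(ℝ, V') p} (hX : IsSectionOn D U X) (hp : p ∈ U) :
    ∃ Z : Π y : N, TangentSpace 𝓘(ℝ, V) y, MDiffAt (T% Z) (L.i p) ∧
      ∀ᶠ q in 𝓝 p, Z (L.i q) = push L.i q (X q) :=
  exists_extension_along L.immersion <|
    ((contMDiffOn_push L.immersion.contMDiff hX.1).contMDiffAt (hU.mem_nhds hp)).mdifferentiableAt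
      (by simp)

theorem ambientCov_eq {X Y : Π p : M, TangentSpace 𝓘(ℝ, V') p}
    {Z : Π y : N, TangentSpace 𝓘(ℝ, V) y} (hZ : MDiffAt (T% Z) (L.i p))
    (h : ∀ᶠ q in 𝓝 p, Z (L.i q) = push L.i q (Y q)) :
    L.ambientCov nabla X Y p = nabla Z (L.i p) (push L.i p (X p)) :=
  covAlong_eq (L.mdifferentiableAt_i p) hZ h _

theorem ambientCov_sub_swap [FiniteDimensional ℝ V'] (hnabla : G.IsLeviCivita nabla)
    {D : Π p : M, Submodule ℝ (TangentSpace 𝓘(ℝ, V') p)} (hU : IsOpen U)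
    {X Y : Π p : M, TangentSpace 𝓘(ℝ, V') p} (hX : IsSectionOn D U X) (hY : IsSectionOn D U Y)
    (hp : p ∈ U) :
    L.ambientCov nabla X Y p - L.ambientCov nabla Y X p =
      push L.i p (mlieBracket 𝓘(ℝ, V') X Y p) := by
  have : CompleteSpace V := FiniteDimensional.complete ℝ V
  have : CompleteSpace V' := FiniteDimensional.complete ℝ V'
  obtain ⟨Zx, hZx, hx⟩ := L.exists_extension hU hX hp
  obtain ⟨Zy, hZy, hy⟩ := L.exists_extension hU hY hp
  rw [L.ambientCov_eq hZx hx, L.ambientCov_eq hZy hy, ← hx.self_of_nhds, ← hy.self_of_nhds,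
    hnabla.torsion_free Zx Zy _ hZx hZy]
  exact mlieBracket_eq_push L.immersion.contMDiff
    ((hX.1.contMDiffAt (hU.mem_nhds hp)).mdifferentiableAt (by simp))
    ((hY.1.contMDiffAt (hU.mem_nhds hp)).mdifferentiableAt (by simp)) hZx hZy hx hy

/-- This is how integrability is used: ∇̄_X Y - ∇̄_Y X is the bracket, which stays in D and so is
invisible to n. -/
theorem g_ambientCov_swap [FiniteDimensional ℝ V'] (hnabla : G.IsLeviCivita nabla)
    {D : Π p : M, Submodule ℝ (TangentSpace 𝓘(ℝ, V') p)} (hD : IsIntegrable D) (hU : IsOpen U)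
    {X Y : Π p : M, TangentSpace 𝓘(ℝ, V') p} (hX : IsSectionOn D U X) (hY : IsSectionOn D U Y)
    (hp : p ∈ U) {n : TangentSpace 𝓘(ℝ, V) (L.i p)}
    (hn : ∀ v ∈ D p, G.g (L.i p) (push L.i p v) n = 0) :
    G.g (L.i p) (L.ambientCov nabla X Y p) n = G.g (L.i p) (L.ambientCov nabla Y X p) n := by
  have h := hn _ (hD U hU X Y hX hY p hp)
  rw [← L.ambientCov_sub_swap hnabla hU hX hY hp, map_sub, sub_apply] at h
  exact sub_eq_zero.1 h

/-- If `D` is integrable and `φ`-invariant, the components of `∇̄_X Y`, for sections `X`, `Y` of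
`D`, in suitable normal directions `n` are anti-invariant under `φ`. -/
theorem g_ambientCov_φ [FiniteDimensional ℝ V'] (hG : G.IsSManifold) (hnabla : G.IsLeviCivita nabla)
    {D : Π p : M, Submodule ℝ (TangentSpace 𝓘(ℝ, V') p)} (hD : IsIntegrable D) (hU : IsOpen U)
    {X Y X' Y' : Π p : M, TangentSpace 𝓘(ℝ, V') p} (hX : IsSectionOn D U X)
    (hY : IsSectionOn D U Y) (hX' : IsSectionOn D U X')
    (hXX' : ∀ q ∈ U, push L.i q (X' q) = G.φ (L.i q) (push L.i q (X q)))
    (hYY' : ∀ q ∈ U, push L.i q (Y' q) = G.φ (L.i q) (push L.i q (Y q)))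
    (hp : p ∈ U) {n : TangentSpace 𝓘(ℝ, V) (L.i p)}
    (hn : ∀ v ∈ D p, G.g (L.i p) (push L.i p v) n = 0)
    (hφn : ∀ v ∈ D p, G.g (L.i p) (push L.i p v) (G.φ (L.i p) n) = 0)
    (hη : ∀ α, G.η α (L.i p) n = 0) :
    G.g (L.i p) (L.ambientCov nabla X' Y' p) n = -G.g (L.i p) (L.ambientCov nabla X Y p) n := by
  obtain ⟨Zx, hZx, hx⟩ := L.exists_extension hU hX hp
  obtain ⟨Zy, hZy, hy⟩ := L.exists_extension hU hY hp
  have hx' : ∀ᶠ q in 𝓝 p, G.φ (L.i q) (Zx (L.i q)) = push L.i q (X' q) := by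
    filter_upwards [hx, hU.mem_nhds hp] with q hq hqU
    rw [hq, hXX' q hqU]
  have hy' : ∀ᶠ q in 𝓝 p, G.φ (L.i q) (Zy (L.i q)) = push L.i q (Y' q) := by
    filter_upwards [hy, hU.mem_nhds hp] with q hq hqU
    rw [hq, hYY' q hqU]
  have e1 : L.ambientCov nabla X' Y' p = G.covφ nabla (L.i p) (push L.i p (Y p))
      (push L.i p (X' p)) + G.φ (L.i p) (L.ambientCov nabla X' Y p) := by
    rw [L.ambientCov_eq (G.mdifferentiableAt_φ hZy) hy', L.ambientCov_eq hZy hy, G.nabla_φ hZy,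
      hy.self_of_nhds]
  have e2 : L.ambientCov nabla Y X' p = G.covφ nabla (L.i p) (push L.i p (X p))
      (push L.i p (Y p)) + G.φ (L.i p) (L.ambientCov nabla Y X p) := by
    rw [L.ambientCov_eq (G.mdifferentiableAt_φ hZx) hx', L.ambientCov_eq hZx hx, G.nabla_φ hZx,
      hx.self_of_nhds]
  have s1 := L.g_ambientCov_swap hnabla hD hU hX hY hp hn
  -- Integrability is applied a second time, to the pair (φX, Y) and the direction φn.
  have s2 := L.g_ambientCov_swap hnabla hD hU hX' hY hp hφn
  have hgy := hn _ (hY.2 p hp)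
  have hgx' := hn _ (hX'.2 p hp)
  have hφy : G.g (L.i p) (G.φ (L.i p) (push L.i p (Y p))) n = 0 := by
    rw [G.g_φ_left, hφn _ (hY.2 p hp), neg_zero]
  -- `c1`, `c2` and `c3` give g((∇_{φX} φ)Y, n) = g((∇_Y φ)φX, n) = g((∇_Y φ)X, φn), so the two ∇φ
  -- terms cancel.
  have c1 := G.covφ_normal_symm hG hnabla hη hgx' hgy
  have c2 := G.covφ_skew hnabla (push L.i p (Y p)) (push L.i p (X' p)) n
  have c3 := G.covφ_φ hnabla (push L.i p (Y p)) (push L.i p (X p)) n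
  simp only [hη, G.nabla_ξ_normal hG hnabla hη _ hφy, mul_zero, add_zero, Finset.sum_const_zero,
    neg_zero] at c3
  rw [← hXX' p hp] at c3
  have c4 := G.compat (L.i p) (L.ambientCov nabla Y X p) n
  simp only [hη, mul_zero, Finset.sum_const_zero, sub_zero] at c4
  rw [e2] at s2
  rw [e1]
  simp only [map_add, add_apply, G.g_φ_left] at s2 c4 ⊢
  linarith

theorem isSectionOn_φTan (hU : IsOpen U) {E : Π p : M, TangentSpace 𝓘(ℝ, V') p}
    (hE : ∀ p ∈ U, E p ∈ L.Rad p) {ν : Π p : M, TangentSpace 𝓘(ℝ, V) (L.i p)}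
    (hν : ∀ p ∈ U, L.IsTransversal p (E p) (ν p)) {X : Π p : M, TangentSpace 𝓘(ℝ, V') p}
    (hX : IsSectionOn L.D₀ U X) : IsSectionOn L.D₀ U (L.φTan X) :=
  ⟨contMDiffOn_of_push L.immersion hU
      (G.contMDiffOn_φ_along L.immersion.contMDiff (contMDiffOn_push L.immersion.contMDiff hX.1))
      fun q hq ↦ L.push_φTan (hE q hq) (hν q hq).ne_zero (hX.2 q hq),
    fun q hq ↦ L.φTan_mem_D₀ (hE q hq) (hν q hq) (hX.2 q hq)⟩

end CharLightlikeHypersurface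

end LightlikeGeometry

theorem mainTheorem10
    -- the ambient manifold and its indefinite S-structure, with Levi-Civita connection `nabla`
    {V : Type*} [NormedAddCommGroup V] [NormedSpace ℝ V] [FiniteDimensional ℝ V]
    {N : Type*} [TopologicalSpace N] [ChartedSpace V N] [IsManifold 𝓘(ℝ, V) ∞ N]
    [T2Space N] [SecondCountableTopology N]
    {r : ℕ} (G : LightlikeGeometry.IndefiniteMetricGFF V N r) (hG : G.IsSManifold)
    (nabla : CovariantDerivative 𝓘(ℝ, V) V (TangentSpace 𝓘(ℝ, V) : N → Type _))
    (hnabla : G.IsLeviCivita nabla)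
    -- the characteristic lightlike hypersurface with its characteristic screen distribution
    {V' : Type*} [NormedAddCommGroup V'] [NormedSpace ℝ V'] [FiniteDimensional ℝ V']
    {M : Type*} [TopologicalSpace M] [ChartedSpace V' M] [IsManifold 𝓘(ℝ, V') ∞ M]
    [T2Space M] [SecondCountableTopology M]
    (L : LightlikeGeometry.CharLightlikeHypersurface V' M G)
    (hD₀ : LightlikeGeometry.IsIntegrable L.D₀)
    -- local sections `E` of `Rad(TM)` and `ν` of `ltr(M)` on an open subset `U`
    (U : Set M) (hU : IsOpen U)
    (E : Π p : M, TangentSpace 𝓘(ℝ, V') p) (hE : LightlikeGeometry.IsSectionOn L.Rad U E)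
    (hE₀ : ∀ p ∈ U, E p ≠ 0)
    (ν : Π p : M, TangentSpace 𝓘(ℝ, V) (L.i p))
    (hν : ContMDiffOn 𝓘(ℝ, V') 𝓘(ℝ, V).tangent ∞
      (fun p ↦ (⟨L.i p, ν p⟩ : TangentBundle 𝓘(ℝ, V) N)) U)
    (hνE : ∀ p ∈ U, L.IsTransversal p (E p) (ν p))
    -- sections of `D₀`
    (X Y : Π p : M, TangentSpace 𝓘(ℝ, V') p)
    (hX : LightlikeGeometry.IsSectionOn L.D₀ U X) (hY : LightlikeGeometry.IsSectionOn L.D₀ U Y) :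
    ∀ p ∈ U,
      L.B nabla E (L.φTan X) (L.φTan Y) p = -L.B nabla E X Y p ∧
      L.C nabla ν (L.φTan X) (L.φTan Y) p = -L.C nabla ν X Y p := by
  intro p hp
  have hEp := hE.2 p hp
  have hn := hνE p hp
  have hX' := L.isSectionOn_φTan hU hE.2 hνE hX
  have hXX' (q : M) (hq : q ∈ U) := L.push_φTan (hE.2 q hq) (hE₀ q hq) (hX.2 q hq)
  have hYY' (q : M) (hq : q ∈ U) := L.push_φTan (hE.2 q hq) (hE₀ q hq) (hY.2 q hq)
  rw [L.B_eq nabla hEp hn, L.B_eq nabla hEp hn, L.C_eq nabla hEp hn, L.C_eq nabla hEp hn]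
  constructor
  -- Here n = E: η^α(E) = 0 because the ξ_α are tangent to M.
  · refine L.g_ambientCov_φ hG hnabla hD₀ hU hX hY hX' hXX' hYY' hp (fun v _ ↦ ?_)
      (fun v hv ↦ hv.2.1 _ hEp) (L.η_push_of_mem_Rad hEp)
    rw [G.symm]
    exact hEp v
  -- Here n = N: D₀ ⊥ N because D₀ ⊂ S(TM), and η^α(N) = 0 because ker φ ⊂ S(TM).
  · refine L.g_ambientCov_φ hG hnabla hD₀ hU hX hY hX' hXX' hYY' hp (fun v hv ↦ ?_)
      (fun v hv ↦ hv.2.2 _ (L.isTransversal_mem_ltr hEp hn)) (L.η_of_isTransversal hn)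
    rw [G.symm]
    exact hn.2.2 v hv.1
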